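/- Let $\epsilon_0,\mu_0\in C^\infty(\mathbb R^3;\mathbb R^{3\times3})$ be $2\pi$-periodic in each variable with symmetric positive definite values, and put $A_0(y)=\mathrm{diag}(\epsilon_0(y),\mu_0(y))$. For $\theta\in\mathbb R^3$ call a field $u$ on $\mathbb R^3$ $\theta$-periodic if $x\mapsto e^{-i\theta\cdot x}u(x)$ is $2\pi$-periodic in each variable, and let $L^2(\mathbb T^3_\theta)$ be the space of $\theta$-periodic $u=(E,B)\in L^2_{\rm loc}(\mathbb R^3;\mathbb C^3\times\mathbb C^3)$. By the spectrum, eigenspaces and multiplicities at $\theta$ we mean those of the spectral problem $$\lambda\,A_0(x)\begin{pmatrix}E\\ B\end{pmatrix}=\begin{pmatrix}\operatorname{curl}B\\ -\operatorname{curl}E\end{pmatrix},\qquad (E,B)\ \ \theta\text{-periodic},$$ that is, of the closed operator $(E,B)\mapsto A_0^{-1}(\operatorname{curl}B,-\operatorname{curl}E)$ in $L^2(\mathbb T^3_\theta)$, taken in the sense of distributions with its maximal domain. Constant multiplicity hypothesis: let $\underline\theta\in\mathbb R^3\setminus\{0\}$, and let $i\underline\omega$, with $\underline\omega\in\mathbb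 R\setminus\{0\}$, be an eigenvalue at $\underline\theta$ of finite multiplicity $\kappa\ge1$. Assume that there are $\delta_1,\delta_2>0$ and a real analytic function $\omega:\{|\theta-\underline\theta|<\delta_1\}\to\mathbb R$ such that, for every $\theta$ with $|\theta-\underline\theta|<\delta_1$, the only point of the spectrum at $\theta$ in the disc $\{\lambda\in\mathbb C:|\lambda-i\underline\omega|<\delta_2\}$ is $i\omega(\theta)$, and it has multiplicity $\kappa$. Define the group velocity $\mathcal V:=-\nabla_\theta\omega(\underline\theta)$. For $y,\xi\in\mathbb R^3$ define the characteristic polynomial of Maxwell's equations $$p(y,\tau,\xi)=\det\left(\tau\begin{pmatrix}\epsilon_0(y)&0\\0&\mu_0(y)\end{pmatrix}+\begin{pmatrix}0&-\xi\wedge\\ \xi\wedge&0\end{pmatrix}\right),$$ where $\xi\wedge$ is the matrix of $v\mapsto\xi\times v$, and put $$\tau_{\max}(y,\xi)=\max\{\tau\in\mathbb R:p(y,\tau,\xi)=0\},\qquad \tau_{\max}(\xi)=\max_{y}\tau_{\max}(y,\xi).$$ Theorem 6.1. Under these assumptions the group velocity does not exceed the maximal speed of propagation of Maxwell's equations: for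 every $\xi\in\mathbb R^3\setminus\{0\}$, $$\xi\cdot\mathcal V\le\tau_{\max}(-\xi).$$ -/

import Mathlib

open MeasureTheory Set

noncomputable section

namespace BlochMaxwell

/-- Euclidean space `ℝ³` (positions, Bloch frequencies and covectors). -/
abbrev R3 : Type := EuclideanSpace ℝ (Fin 3)

/-- `ℂ³ × ℂ³` with its Hermitian inner product; `Sum.inl i` indexes the components of `E`
and `Sum.inr i` those of `B`. -/
abbrev C6 : Type := EuclideanSpace ℂ (Fin 3 ⊕ Fin 3)

/-- `2π`-periodicity in each coordinate of `ℝ³`. -/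
def IsPeriodic {α : Type*} (g : R3 → α) : Prop :=
  ∀ (j : Fin 3) (x : R3), g (x + EuclideanSpace.single j (2 * Real.pi)) = g x

/-- `g` is `θ`-periodic: `x ↦ e^{-iθ·x} g(x)` is `2π`-periodic. -/
def IsThetaPeriodic (θ : R3) (g : R3 → C6) : Prop :=
  IsPeriodic fun x => Complex.exp (-(Complex.I * ((inner ℝ θ x : ℝ) : ℂ))) • g x

/-- A periodic medium: smooth, `2π`-periodic permittivity `ε₀` and permeability `μ₀` whose values
are real symmetric positive definite `3 × 3` matrices. -/
structure PeriodicMedium where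
  eps : R3 → Matrix (Fin 3) (Fin 3) ℝ
  mu : R3 → Matrix (Fin 3) (Fin 3) ℝ
  eps_smooth : ∀ i j, ContDiff ℝ (⊤ : ℕ∞) fun y => eps y i j
  mu_smooth : ∀ i j, ContDiff ℝ (⊤ : ℕ∞) fun y => mu y i j
  eps_periodic : IsPeriodic eps
  mu_periodic : IsPeriodic mu
  eps_posDef : ∀ y, (eps y).PosDef
  mu_posDef : ∀ y, (mu y).PosDef

/-- The matrix of `v ↦ ξ ∧ v` (cross product in three dimensions). -/
def wedge (ξ : R3) : Matrix (Fin 3) (Fin 3) ℝ :=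
  !![0, -ξ 2, ξ 1;
     ξ 2, 0, -ξ 0;
     -ξ 1, ξ 0, 0]

/-- The block diagonal matrix `A₀(y) = diag(ε₀(y), μ₀(y))`. -/
def PeriodicMedium.A0 (M : PeriodicMedium) (y : R3) : Matrix (Fin 3 ⊕ Fin 3) (Fin 3 ⊕ Fin 3) ℝ :=
  Matrix.fromBlocks (M.eps y) 0 0 (M.mu y)

/-- `A₀(y)` as a linear map of `ℂ³ × ℂ³`. -/
def PeriodicMedium.A0C (M : PeriodicMedium) (y : R3) : C6 →L[ℂ] C6 :=
  Matrix.toEuclideanCLM (𝕜 := ℂ) ((M.A0 y).map fun r : ℝ => (r : ℂ))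

/-! ### Speeds of propagation of Maxwell's equations -/

/-- The characteristic polynomial `p(y, τ, ξ)` of Maxwell's equations. -/
def PeriodicMedium.charPoly (M : PeriodicMedium) (y : R3) (τ : ℝ) (ξ : R3) : ℝ :=
  (τ • M.A0 y + Matrix.fromBlocks 0 (-wedge ξ) (wedge ξ) 0).det

/-- `τ_max(y, ξ)`, the largest root `τ` of `p(y, τ, ξ)`. The set of roots is finite and contains
`0`, so that the supremum is a maximum. -/
def PeriodicMedium.tauMaxAt (M : PeriodicMedium) (y ξ : R3) : ℝ :=
  sSup {τ : ℝ | M.charPoly y τ ξ = 0}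

/-- `τ_max(ξ)`, the maximum of `τ_max(y, ξ)` over `y` in the torus (a supremum over all `y ∈ ℝ³`,
which is attained because `y ↦ τ_max(y, ξ)` is continuous and periodic). -/
def PeriodicMedium.tauMax (M : PeriodicMedium) (ξ : R3) : ℝ :=
  sSup (range fun y : R3 => M.tauMaxAt y ξ)

/-! ### The Maxwell operator on `θ`-periodic fields -/

/-- `∂_j f`. -/
def pd (j : Fin 3) (f : R3 → ℂ) (x : R3) : ℂ :=
  fderiv ℝ f x (EuclideanSpace.single j 1)

/-- The curl of a (smooth) complex vector field on `ℝ³`. -/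
def curl (F : R3 → Fin 3 → ℂ) (x : R3) : Fin 3 → ℂ :=
  ![pd 1 (fun y => F y 2) x - pd 2 (fun y => F y 1) x,
    pd 2 (fun y => F y 0) x - pd 0 (fun y => F y 2) x,
    pd 0 (fun y => F y 1) x - pd 1 (fun y => F y 0) x]

/-- `G (E, B) = (curl B, -curl E)` on smooth fields. -/
def maxwellG (U : R3 → C6) (x : R3) : C6 :=
  WithLp.toLp 2 (Sum.elim (curl (fun y i => U y (Sum.inr i)) x)
    (-curl (fun y i => U y (Sum.inl i)) x))

/-- The period cell `[0, 2π[³`. -/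
def cell : Set R3 := {x | ∀ i, x i ∈ Ico 0 (2 * Real.pi)}

/-- `L²(𝕋³_θ)`: a `θ`-periodic function in `L²_loc(ℝ³)` is determined by, and may be any
`L²` function on, the period cell. -/
abbrev L2cell : Type := Lp C6 2 (volume.restrict cell)

/-- Test fields: the smooth `θ`-periodic fields on `ℝ³`. -/
def IsTest (θ : R3) (φ : R3 → C6) : Prop :=
  ContDiff ℝ (⊤ : ℕ∞) φ ∧ IsThetaPeriodic θ φ

/-- `G u = A₀ f` in the sense of distributions on `θ`-periodic fields, that is `A₀⁻¹ G u = f`.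
The set of such pairs `(u, f)` is the graph of the closed operator `A₀⁻¹ G` in `L²(𝕋³_θ)`, with
its maximal domain, on which `G` is antiselfadjoint. -/
def PeriodicMedium.InGraph (M : PeriodicMedium) (θ : R3) (u f : L2cell) : Prop :=
  ∀ φ : R3 → C6, IsTest θ φ →
    ∫ x in cell, inner ℂ (φ x) (M.A0C x (f x)) = -∫ x in cell, inner ℂ (maxwellG φ x) (u x)

/-- `z` is in the resolvent set of the closed operator `A₀⁻¹ G` in `L²(𝕋³_θ)`: the map
`u ↦ z u - A₀⁻¹ G u` is a bijection from the domain onto `L²(𝕋³_θ)` (its inverse is then bounded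
by the closed graph theorem). -/
def PeriodicMedium.InResolvent (M : PeriodicMedium) (θ : R3) (z : ℂ) : Prop :=
  ∀ g : L2cell, ∃! u : L2cell, M.InGraph θ u (z • u - g)

/-- The spectrum at Bloch frequency `θ` of `λ A₀ u = G u`, `u` `θ`-periodic. -/
def PeriodicMedium.spectrum (M : PeriodicMedium) (θ : R3) : Set ℂ :=
  {z | ¬ M.InResolvent θ z}

theorem isBounded_cell : Bornology.IsBounded cell := by
  refine Metric.isBounded_closedBall (x := (0 : R3)) (r := 2 * Real.pi * 3) |>.subset ?_
  intro x hx
  rw [mem_closedBall_zero_iff, EuclideanSpace.norm_eq, Real.sqrt_le_left (by positivity)]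
  simp only [Fin.sum_univ_three, Real.norm_eq_abs, sq_abs]
  have h : ∀ i, x i ^ 2 ≤ (2 * Real.pi) ^ 2 := fun i =>
    pow_le_pow_left₀ (hx i).1 (hx i).2.le 2
  nlinarith [h 0, h 1, h 2, sq_nonneg Real.pi]

theorem integrableOn_clm {L : R3 → C6 →L[ℂ] ℂ} (hL : Continuous L) (u : L2cell) :
    Integrable (fun x => L x (u x)) (volume.restrict cell) := by
  have : IsFiniteMeasure (volume.restrict cell : Measure R3) :=
    ⟨by simpa using isBounded_cell.measure_lt_top⟩
  have hm : MeasurableSet cell := by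
    have : cell = ⋂ i, (fun x : R3 => x i) ⁻¹' Ico 0 (2 * Real.pi) := by
      ext x; simp [cell]
    rw [this]
    exact MeasurableSet.iInter fun i => measurableSet_Ico.preimage (by fun_prop)
  have hu : Integrable u (volume.restrict cell) := (Lp.memLp u).integrable (by norm_num)
  obtain ⟨C, hC⟩ := isBounded_cell.isCompact_closure.exists_bound_of_continuousOn hL.continuousOn
  refine (hu.norm.const_mul C).mono' ?_ ?_
  · exact (isBoundedBilinearMap_apply (𝕜 := ℂ) (E := C6) (F := ℂ)).continuous.comp_aestronglyMeasurable
      (hL.aestronglyMeasurable.prodMk hu.aestronglyMeasurable)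
  · filter_upwards [ae_restrict_mem hm] with x hx
    exact (ContinuousLinearMap.le_opNorm _ _).trans
      (mul_le_mul_of_nonneg_right (hC x (subset_closure hx)) (norm_nonneg _))

theorem PeriodicMedium.continuous_A0C (M : PeriodicMedium) : Continuous M.A0C := by
  have h1 : Continuous fun y => (M.A0 y).map fun r : ℝ => (r : ℂ) := by
    refine continuous_matrix fun i j => Complex.continuous_ofReal.comp ?_
    rcases i with i | i <;> rcases j with j | j
    · exact (M.eps_smooth i j).continuous
    · exact continuous_const
    · exact continuous_const
    · exact (M.mu_smooth i j).continuous
  exact (LinearMap.continuous_of_finiteDimensional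
    (Matrix.toEuclideanCLM (n := Fin 3 ⊕ Fin 3) (𝕜 := ℂ)).toAlgEquiv.toLinearMap).comp h1

theorem continuous_maxwellG {φ : R3 → C6} (h : ContDiff ℝ (⊤ : ℕ∞) φ) : Continuous (maxwellG φ) := by
  have hc : ∀ (j : Fin 3) (i : Fin 3 ⊕ Fin 3), Continuous (pd j fun y => φ y i) := by
    intro j i
    have : ContDiff ℝ (⊤ : ℕ∞) fun y => φ y i :=
      (EuclideanSpace.proj (𝕜 := ℂ) i).restrictScalars ℝ |>.contDiff.comp h
    exact (this.continuous_fderiv (by simp)).clm_apply continuous_const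
  refine (PiLp.continuous_toLp 2 _).comp (continuous_pi fun i => ?_)
  rcases i with i | i <;> fin_cases i <;>
    simp only [Sum.elim_inl, Sum.elim_inr, curl, Pi.neg_apply] <;>
    first
    | exact (hc _ _).sub (hc _ _)
    | exact ((hc _ _).sub (hc _ _)).neg

theorem PeriodicMedium.integrable_left (M : PeriodicMedium) {θ : R3} {φ : R3 → C6}
    (h : IsTest θ φ) (f : L2cell) :
    Integrable (fun x => inner ℂ (φ x) (M.A0C x (f x))) (volume.restrict cell) :=
  integrableOn_clm (L := fun x => (innerSL ℂ (φ x)).comp (M.A0C x))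
    (((innerSL ℂ).continuous.comp h.1.continuous).clm_comp M.continuous_A0C) f

theorem integrable_right {θ : R3} {φ : R3 → C6} (h : IsTest θ φ) (u : L2cell) :
    Integrable (fun x => inner ℂ (maxwellG φ x) (u x)) (volume.restrict cell) :=
  integrableOn_clm (L := fun x => innerSL ℂ (maxwellG φ x))
    ((innerSL ℂ).continuous.comp (continuous_maxwellG h.1)) u

theorem PeriodicMedium.InGraph.add {M : PeriodicMedium} {θ : R3} {u f v g : L2cell}
    (h : M.InGraph θ u f) (k : M.InGraph θ v g) : M.InGraph θ (u + v) (f + g) := by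
  intro φ hφ
  have e1 : ∫ x in cell, inner ℂ (φ x) (M.A0C x ((f + g : L2cell) x)) =
      ∫ x in cell, (inner ℂ (φ x) (M.A0C x (f x)) + inner ℂ (φ x) (M.A0C x (g x))) := by
    refine integral_congr_ae ?_
    filter_upwards [Lp.coeFn_add f g] with x hx
    rw [hx, Pi.add_apply, map_add, inner_add_right]
  have e2 : ∫ x in cell, inner ℂ (maxwellG φ x) ((u + v : L2cell) x) =
      ∫ x in cell, (inner ℂ (maxwellG φ x) (u x) + inner ℂ (maxwellG φ x) (v x)) := by
    refine integral_congr_ae ?_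
    filter_upwards [Lp.coeFn_add u v] with x hx
    rw [hx, Pi.add_apply, inner_add_right]
  rw [e1, e2, integral_add (M.integrable_left hφ f) (M.integrable_left hφ g),
    integral_add (integrable_right hφ u) (integrable_right hφ v), h φ hφ, k φ hφ, neg_add]

theorem PeriodicMedium.InGraph.smul {M : PeriodicMedium} {θ : R3} {u f : L2cell} (c : ℂ)
    (h : M.InGraph θ u f) : M.InGraph θ (c • u) (c • f) := by
  intro φ hφ
  have e1 : ∫ x in cell, inner ℂ (φ x) (M.A0C x ((c • f : L2cell) x)) =
      ∫ x in cell, c * inner ℂ (φ x) (M.A0C x (f x)) := by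
    refine integral_congr_ae ?_
    filter_upwards [Lp.coeFn_smul c f] with x hx
    rw [hx, Pi.smul_apply, map_smul, inner_smul_right]
  have e2 : ∫ x in cell, inner ℂ (maxwellG φ x) ((c • u : L2cell) x) =
      ∫ x in cell, c * inner ℂ (maxwellG φ x) (u x) := by
    refine integral_congr_ae ?_
    filter_upwards [Lp.coeFn_smul c u] with x hx
    rw [hx, Pi.smul_apply, inner_smul_right]
  rw [e1, e2, integral_const_mul, integral_const_mul, h φ hφ, mul_neg]

/-- The eigenspace `{u ∈ L²(𝕋³_θ) : z A₀ u = G u}`. -/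
def PeriodicMedium.eigenspace (M : PeriodicMedium) (θ : R3) (z : ℂ) : Submodule ℂ L2cell where
  carrier := {u | M.InGraph θ u (z • u)}
  zero_mem' := by
    have h : M.InGraph θ (0 : L2cell) (0 : L2cell) := by
      intro φ _
      have e1 : ∫ x in cell, inner ℂ (φ x) (M.A0C x ((0 : L2cell) x)) = ∫ x in cell, (0 : ℂ) := by
        refine integral_congr_ae ?_
        filter_upwards [Lp.coeFn_zero C6 2 (volume.restrict cell)] with x hx
        rw [hx, Pi.zero_apply, map_zero, inner_zero_right]
      have e2 : ∫ x in cell, inner ℂ (maxwellG φ x) ((0 : L2cell) x) = ∫ x in cell, (0 : ℂ) := by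
        refine integral_congr_ae ?_
        filter_upwards [Lp.coeFn_zero C6 2 (volume.restrict cell)] with x hx
        rw [hx, Pi.zero_apply, inner_zero_right]
      rw [e1, e2]; simp
    simpa only [mem_ofPred_eq, smul_zero] using h
  add_mem' := by
    intro u v hu hv
    simpa only [mem_ofPred_eq, smul_add] using PeriodicMedium.InGraph.add hu hv
  smul_mem' := by
    intro c u hu
    simpa only [mem_ofPred_eq, smul_comm z c u] using PeriodicMedium.InGraph.smul c hu

/-- The constant multiplicity hypothesis at the nonzero eigenvalue `i ω₀` of multiplicity `κ` at
the Bloch frequency `θ₀`: for `θ` near `θ₀` the only point of the spectrum near `i ω₀` is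
`i ω(θ)`, with `ω` real analytic and `i ω(θ)` of multiplicity `κ`. (Since `A₀⁻¹ G` is
antiselfadjoint for the inner product weighted by `A₀`, the multiplicity is the dimension of the
eigenspace.) -/
structure PeriodicMedium.ConstantMultiplicity (M : PeriodicMedium) (θ₀ : R3) (ω₀ : ℝ) (κ : ℕ)
    (ω : R3 → ℝ) : Prop where
  theta_ne_zero : θ₀ ≠ 0
  omega_ne_zero : ω₀ ≠ 0
  one_le_mult : 1 ≤ κ
  mult_eq : Module.finrank ℂ (M.eigenspace θ₀ (Complex.I * (ω₀ : ℂ))) = κ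
  exists_radii : ∃ δ₁ > (0 : ℝ), ∃ δ₂ > (0 : ℝ),
    AnalyticOnNhd ℝ ω (Metric.ball θ₀ δ₁) ∧
    ∀ θ ∈ Metric.ball θ₀ δ₁,
      M.spectrum θ ∩ Metric.ball (Complex.I * (ω₀ : ℂ)) δ₂ = {Complex.I * (ω θ : ℂ)} ∧
      Module.finrank ℂ (M.eigenspace θ (Complex.I * (ω θ : ℂ))) = κ

/-- The group velocity `𝒱 = -∇_θ ω(θ₀)`. -/
def groupVelocity (ω : R3 → ℝ) (θ₀ : R3) : R3 :=
  -gradient ω θ₀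

end BlochMaxwell

end

/-!
Write `A = A₀` and let `S(η)` be the symmetric symbol with
`e^{-iη·x} G e^{iη·x} = G + i S(η)`. Conjugating with the plane wave turns the problem at the Bloch
frequency `θ₀ + tη` into a problem at the fixed frequency `θ₀`, perturbed by the bounded term
`i t S(η)`. First order perturbation theory then gives
`∂_η ω(θ₀) = ⟨S(η) w, w⟩ / ⟨A w, w⟩` for an eigenvector `w`, and the pointwise bound
`S(η) ≤ τ_max(η) A₀(y)` of quadratic forms (`symbol_le_tauMax`) yields
`∂_η ω(θ₀) ≤ τ_max(η)`. The theorem is the case `η = -ξ`. The pointwise bound holds because the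
maximum over `x` of `⟨S x, x⟩ / ⟨A₀(y) x, x⟩` is itself a root of the characteristic polynomial.

Neither differentiability nor convergence of eigenvectors in `t` is needed. If `w` is the conjugated
eigenvector at `θ₀ + tη`, then `(i ω₀ - A⁻¹ G) w = O(t)` at the frequency `θ₀`. Since `i ω₀` is
isolated in the spectrum there, `w` is within `O(t)` of an eigenvector `p` at `θ₀`
(`exists_near_kernel`, by the functional calculus for a resolvent, which is bounded and normal).
Pairing the equation of `w` with `p` gives `(ω(θ₀ + tη) - ω₀) ⟨A w, p⟩ = t ⟨S(η) w, p⟩`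
exactly, whence the inequality as `t → 0⁺` (`deriv_eigenvalue_le`).

All this uses that `G` is skew-symmetric on its maximal domain
(`PeriodicMedium.InGraph.skew`). Testing against plane waves shows that on Fourier coefficients at
the frequency `θ + k` the relation `G u = A f` is multiplication by `i S(θ + k)`, and Parseval's
identity, transported from the torus `(ℝ/ℤ)³` to the period cell, does the rest.
-/

noncomputable section

namespace BlochMaxwell

/-! ### Isolated points of the spectrum of a skew-symmetric relation -/

section IsolatedSpectrum

/-- If `m` is isolated in the spectrum of a normal element `a`, then `a - m` has a partial inverse:
`q` is the spectral projection on `{m}`, and `f` inverts `a - m` off the range of `q`. -/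
theorem exists_partial_inverse_of_isolated {𝒜 : Type*} [CStarAlgebra 𝒜] (a : 𝒜) [IsStarNormal a]
    {m : ℂ} {r : ℝ} (hr : 0 < r) (h : ∀ z ∈ _root_.spectrum ℂ a, ‖z - m‖ < r → z = m) :
    ∃ f q : 𝒜, (a - algebraMap ℂ 𝒜 m) * q = 0 ∧ f * (a - algebraMap ℂ 𝒜 m) = 1 - q := by
  -- With the convention `0⁻¹ = 0` this function vanishes at `m`.
  have hc : ContinuousOn (fun z : ℂ => (z - m)⁻¹) (_root_.spectrum ℂ a) := by
    intro z hz
    rcases eq_or_ne z m with rfl | hzm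
    · have : nhdsWithin z (_root_.spectrum ℂ a) ≤ pure z := by
        rw [Filter.le_pure_iff, mem_nhdsWithin]
        refine ⟨Metric.ball z r, Metric.isOpen_ball, Metric.mem_ball_self hr, fun y hy => ?_⟩
        exact h y hy.2 (by simpa [dist_eq_norm] using hy.1)
      exact (tendsto_pure_nhds _ _).mono_left this
    · exact ((continuous_id.sub continuous_const).continuousAt.inv₀
        (sub_ne_zero.mpr hzm)).continuousWithinAt
  have ha : a - algebraMap ℂ 𝒜 m = cfc (fun z : ℂ => z - m) a := by
    rw [cfc_sub (fun z : ℂ => z) (fun _ => m) a, cfc_id' ℂ a, cfc_const m a]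
  have hs : ContinuousOn (fun z : ℂ => z - m) (_root_.spectrum ℂ a) := by fun_prop
  refine ⟨cfc (fun z : ℂ => (z - m)⁻¹) a,
    1 - cfc (fun z : ℂ => (z - m)⁻¹) a * (a - algebraMap ℂ 𝒜 m), ?_, by simp⟩
  rw [mul_sub, mul_one, ha, ← cfc_mul (fun z => (z - m)⁻¹) _ a hc hs,
    ← cfc_mul _ (fun z => (z - m)⁻¹ * (z - m)) a hs (hc.mul hs),
    sub_eq_zero]
  refine cfc_congr fun z _ => ?_
  rcases eq_or_ne z m with rfl | hzm
  · simp
  · have := sub_ne_zero.mpr hzm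
    simp [this]

variable {H : Type*} [NormedAddCommGroup H] [InnerProductSpace ℂ H] [CompleteSpace H]

/-- Let the linear relation `Γ` (the graph of an operator `T`) be skew-symmetric and let every
`ζ ≠ i ω₀` with `|ζ - i ω₀| < δ` be in its resolvent set. Then `i ω₀ - T` is bounded below modulo
its kernel: if `i ω₀ u - T u = g`, then `u` is within `C ‖g‖` of the kernel. The proof applies the
functional calculus to a resolvent of `T`, which is a bounded normal operator. -/
theorem exists_near_kernel (Γ : Submodule ℂ (H × H))
    (skew : ∀ p ∈ Γ, ∀ q ∈ Γ, inner ℂ p.2 q.1 = -inner ℂ p.1 q.2) {ω₀ δ : ℝ} (hδ : 0 < δ)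
    (hres : ∀ ζ : ℂ, ζ ≠ Complex.I * ω₀ → ‖ζ - Complex.I * ω₀‖ < δ →
      ∀ g : H, ∃! u : H, (u, ζ • u - g) ∈ Γ) :
    ∃ C : ℝ, 0 ≤ C ∧ ∀ u g : H, (u, (Complex.I * ω₀) • u - g) ∈ Γ →
      ∃ p : H, (p, (Complex.I * ω₀) • p) ∈ Γ ∧ ‖u - p‖ ≤ C * ‖g‖ := by
  set z₀ : ℂ := Complex.I * ω₀ with hz₀
  -- `z` is purely imaginary, so that its resolvent `R` is skew-adjoint.
  set z : ℂ := Complex.I * ((ω₀ + δ / 2 : ℝ) : ℂ) with hz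
  have hzz : z - z₀ = Complex.I * ((δ / 2 : ℝ) : ℂ) := by rw [hz, hz₀]; push_cast; ring
  have hδ2 : ((δ / 2 : ℝ) : ℂ) ≠ 0 := by exact_mod_cast (half_pos hδ).ne'
  have hzne : z - z₀ ≠ 0 := by rw [hzz]; exact mul_ne_zero Complex.I_ne_zero hδ2
  have hznorm : ‖z - z₀‖ < δ := by
    rw [hzz, norm_mul, Complex.norm_I, one_mul, Complex.norm_real, Real.norm_eq_abs,
      abs_of_pos (half_pos hδ)]
    exact half_lt_self hδ
  have hconj : (starRingEnd ℂ) z = -z := by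
    rw [hz, map_mul, Complex.conj_I, Complex.conj_ofReal]; ring
  choose R₀ hR₀ hR₀u using fun g => hres z (sub_ne_zero.mp hzne) hznorm g
  have hadd : ∀ g h, R₀ (g + h) = R₀ g + R₀ h := by
    intro g h
    refine (hR₀u (g + h) _ ?_).symm
    have := Γ.add_mem (hR₀ g) (hR₀ h)
    simp only [Prod.mk_add_mk] at this
    convert this using 2
    rw [smul_add]; abel
  have hsmul : ∀ (c : ℂ) g, R₀ (c • g) = c • R₀ g := by
    intro c g
    refine (hR₀u (c • g) _ ?_).symm
    have := Γ.smul_mem c (hR₀ g)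
    simp only [Prod.smul_mk] at this
    convert this using 2
    rw [smul_sub, smul_comm]
  have hskew : ∀ g h, inner ℂ (R₀ g) h = -inner ℂ g (R₀ h) := by
    intro g h
    have := skew _ (hR₀ g) _ (hR₀ h)
    simp only [inner_sub_left, inner_sub_right, inner_smul_left, inner_smul_right, hconj] at this
    linear_combination -this
  let K : H →ₗ[ℂ] H :=
    { toFun := fun g => Complex.I • R₀ g
      map_add' := fun g h => by rw [hadd, smul_add]
      map_smul' := fun c g => by rw [hsmul, smul_comm, RingHom.id_apply] }
  -- Continuity of `R` is automatic, by the Hellinger–Toeplitz theorem for `i R`.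
  have hK : K.IsSymmetric := by
    intro g h
    change inner ℂ (Complex.I • R₀ g) h = inner ℂ g (Complex.I • R₀ h)
    rw [inner_smul_left, inner_smul_right, hskew, Complex.conj_I]; ring
  let R : H →L[ℂ] H := (-Complex.I) • (⟨K, hK.continuous⟩ : H →L[ℂ] H)
  have hR : ∀ g, R g = R₀ g := by
    intro g
    change (-Complex.I) • (Complex.I • R₀ g) = R₀ g
    rw [smul_smul]; simp
  have hRstar : star R = -R := by
    rw [ContinuousLinearMap.star_eq_adjoint]
    refine (ContinuousLinearMap.eq_adjoint_iff (-R) R).mpr (fun x y => ?_) |>.symm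
    rw [neg_apply, inner_neg_left, hR, hR, hskew, neg_neg]
  have : IsStarNormal R := ⟨by rw [hRstar]; exact (Commute.refl R).neg_left⟩
  set m : ℂ := (z - z₀)⁻¹ with hm
  have hmne : m ≠ 0 := inv_ne_zero hzne
  -- `ζ ↦ (z - ζ)⁻¹` maps the punctured disc about `z₀` to a punctured neighbourhood of `m`.
  have hζ : ∀ᶠ w in nhds m, w ≠ 0 ∧ ‖(z - w⁻¹) - z₀‖ < δ := by
    refine (continuousAt_id.eventually_ne hmne).and ?_
    have hcont : ContinuousAt (fun w : ℂ => ‖(z - w⁻¹) - z₀‖) m :=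
      (((continuousAt_const.sub (continuousAt_inv₀ hmne)).sub continuousAt_const)).norm
    refine hcont.eventually_lt_const ?_
    simpa [hm] using hδ
  obtain ⟨r, hr, hball⟩ := Metric.eventually_nhds_iff.mp hζ
  have hiso : ∀ w ∈ _root_.spectrum ℂ R, ‖w - m‖ < r → w = m := by
    intro w hw hwr
    by_contra hwm
    obtain ⟨hw0, hwδ⟩ := hball (y := w) (by rwa [dist_eq_norm])
    set ζ : ℂ := z - w⁻¹ with hζd
    have hζne : ζ ≠ z₀ := by
      intro h
      apply hwm
      rw [hm, ← h, hζd]; simp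
    have hex := hres ζ hζne hwδ
    refine hw (ContinuousLinearMap.isUnit_iff_bijective.mpr ?_)
    have happ : ∀ x, (algebraMap ℂ (H →L[ℂ] H) w - R) x = w • x - R₀ x := by
      intro x
      rw [sub_apply, hR, Algebra.algebraMap_eq_smul_one]
      rfl
    constructor
    · refine (injective_iff_map_eq_zero _).mpr fun x hx => ?_
      rw [happ, sub_eq_zero] at hx
      have h1 := hR₀ x
      rw [← hx] at h1
      have h2 : (w • x, ζ • (w • x) - 0) ∈ Γ := by
        convert h1 using 2
        rw [hζd, sub_smul, smul_smul w⁻¹, inv_mul_cancel₀ hw0, one_smul, sub_zero]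
      have h3 : ((0 : H), ζ • (0 : H) - 0) ∈ Γ := by
        rw [smul_zero, sub_zero]; exact Γ.zero_mem
      have h4 := (hex 0).unique h2 h3
      exact (smul_eq_zero.mp h4).resolve_left hw0
    · intro y
      obtain ⟨u, hu, -⟩ := hex (w⁻¹ • y)
      have h1 : R₀ (w⁻¹ • u + w⁻¹ • y) = u := by
        refine (hR₀u _ _ ?_).symm
        convert hu using 2
        rw [hζd, sub_smul]; abel
      refine ⟨w⁻¹ • u + w⁻¹ • y, ?_⟩
      rw [happ, h1, smul_add, smul_smul, smul_smul, mul_inv_cancel₀ hw0, one_smul, one_smul]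
      abel
  obtain ⟨f, q, hq, hf⟩ := exists_partial_inverse_of_isolated R hr hiso
  refine ⟨‖f‖ * ‖m‖ * ‖R‖, by positivity, fun u g hu => ⟨q u, ?_, ?_⟩⟩
  · have h1 : R₀ (q u) = m • q u := by
      have := congrArg (fun L : H →L[ℂ] H => L u) hq
      simp only [mul_apply_eq_comp, sub_apply, hR,
        Algebra.algebraMap_eq_smul_one, smul_apply,
        one_apply_eq_self, zero_apply] at this
      exact sub_eq_zero.mp this
    have h2 := Γ.smul_mem (z - z₀) (hR₀ (q u))
    rw [h1] at h2
    convert h2 using 1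
    simp only [Prod.smul_mk, smul_sub, smul_smul, hm]
    rw [mul_inv_cancel₀ hzne, one_smul, mul_comm z, ← mul_assoc, mul_inv_cancel₀ hzne, one_mul,
      ← sub_smul]
    congr 2; ring
  · have h1 : R₀ ((z - z₀) • u + g) = u := by
      refine (hR₀u _ _ ?_).symm
      convert hu using 2
      rw [sub_smul]; abel
    have h2 : (R - algebraMap ℂ (H →L[ℂ] H) m) u = -(m • R g) := by
      have h3 : (z - z₀) • R₀ u + R₀ g = u := by rw [← hsmul, ← hadd, h1]
      have h4 : R₀ u = m • (u - R₀ g) := by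
        rw [← h3, add_sub_cancel_right, h3, smul_smul, hm, inv_mul_cancel₀ hzne, one_smul]
      rw [sub_apply, hR, hR, Algebra.algebraMap_eq_smul_one,
        smul_apply, one_apply_eq_self, h4, smul_sub]
      abel
    have h5 := congrArg (fun L : H →L[ℂ] H => L u) hf
    simp only [mul_apply_eq_comp] at h5
    rw [h2, sub_apply, one_apply_eq_self] at h5
    rw [← h5]
    calc ‖f (-(m • R g))‖ ≤ ‖f‖ * (‖m‖ * (‖R‖ * ‖g‖)) := by
          refine (f.le_opNorm _).trans ?_
          rw [norm_neg, norm_smul]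
          gcongr
          exact R.le_opNorm g
      _ = _ := by ring

/-- The weighted form of `exists_near_kernel`: here `Γ` is skew-symmetric for the inner product
`⟨A ·, ·⟩` of a bounded, symmetric and coercive `A`. Conjugating with `A^{1/2}` reduces it to the
unweighted form. -/
theorem exists_near_kernel_weighted (A : H →L[ℂ] H) (hA : IsSelfAdjoint A) {c : ℝ} (hc : 0 < c)
    (hAc : ∀ x, c * ‖x‖ ^ 2 ≤ (inner ℂ (A x) x).re) (Γ : Submodule ℂ (H × H))
    (skew : ∀ p ∈ Γ, ∀ q ∈ Γ, inner ℂ (A p.2) q.1 = -inner ℂ p.1 (A q.2)) {ω₀ δ : ℝ} (hδ : 0 < δ)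
    (hres : ∀ ζ : ℂ, ζ ≠ Complex.I * ω₀ → ‖ζ - Complex.I * ω₀‖ < δ →
      ∀ g : H, ∃! u : H, (u, ζ • u - g) ∈ Γ) :
    ∃ C : ℝ, 0 ≤ C ∧ ∀ u g : H, (u, (Complex.I * ω₀) • u - g) ∈ Γ →
      ∃ p : H, (p, (Complex.I * ω₀) • p) ∈ Γ ∧ ‖u - p‖ ≤ C * ‖g‖ := by
  have hApos : 0 ≤ A := by
    rw [ContinuousLinearMap.nonneg_iff_isPositive, ContinuousLinearMap.isPositive_def']
    exact ⟨hA, fun x => (by positivity : 0 ≤ c * ‖x‖ ^ 2).trans (hAc x)⟩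
  have hAu : IsUnit A := by
    refine A.isUnit_of_forall_le_norm_inner_map (c := ⟨c, hc.le⟩) hc fun x => ?_
    rw [mul_comm]
    exact (hAc x).trans (Complex.re_le_norm _)
  set B : H →L[ℂ] H := CFC.sqrt A with hB
  have hBB : B * B = A := CFC.sqrt_mul_sqrt_self A hApos
  have hBsa : IsSelfAdjoint B := (CFC.sqrt_nonneg A).isSelfAdjoint
  have hBu : IsUnit B := by
    rw [← hBB] at hAu
    exact ((Commute.refl B).isUnit_mul_iff.mp hAu).1
  obtain ⟨U, hU⟩ := hBu
  set D : H →L[ℂ] H := ((U⁻¹ : (H →L[ℂ] H)ˣ) : H →L[ℂ] H) with hD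
  have hDB : ∀ x, D (B x) = x := fun x => by
    rw [← mul_apply_eq_comp, ← hU, hD, Units.inv_mul, one_apply_eq_self]
  have hBD : ∀ x, B (D x) = x := fun x => by
    rw [← mul_apply_eq_comp, ← hU, hD, Units.mul_inv, one_apply_eq_self]
  have hBsymm : ∀ x y, inner ℂ (B x) y = inner ℂ x (B y) := fun x y => hBsa.isSymmetric x y
  have hBin : ∀ x y, inner ℂ (B x) (B y) = inner ℂ (A x) y := fun x y => by
    rw [← hBB, mul_apply_eq_comp, hBsymm (B x) y]
  have hBin' : ∀ x y, inner ℂ (B x) (B y) = inner ℂ x (A y) := fun x y => by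
    rw [← hBB, mul_apply_eq_comp, hBsymm]
  let Γ' : Submodule ℂ (H × H) := Γ.comap ((D : H →ₗ[ℂ] H).prodMap (D : H →ₗ[ℂ] H))
  have hΓ' : ∀ x y, (x, y) ∈ Γ' ↔ (D x, D y) ∈ Γ := fun x y => Iff.rfl
  obtain ⟨C, hC, h⟩ := exists_near_kernel Γ' (fun p hp q hq => by
    have := skew _ hp _ hq
    simp only [LinearMap.prodMap_apply, ContinuousLinearMap.coe_coe] at this
    rwa [← hBin, ← hBin', hBD, hBD, hBD, hBD] at this) hδ (fun ζ h1 h2 g => by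
    obtain ⟨u, hu, huu⟩ := hres ζ h1 h2 (D g)
    refine ⟨B u, ?_, fun v hv => ?_⟩
    · simp only [hΓ', map_sub, map_smul, hDB]; exact hu
    · simp only [hΓ', map_sub, map_smul] at hv
      rw [← huu _ hv, hBD])
  refine ⟨‖D‖ * C * ‖B‖, by positivity, fun u g hu => ?_⟩
  obtain ⟨p, hp, hup⟩ := h (B u) (B g) (by
    simp only [hΓ', map_sub, map_smul, hDB]; exact hu)
  refine ⟨D p, by simpa only [hΓ', map_smul] using hp, ?_⟩
  calc ‖u - D p‖ = ‖D (B u - p)‖ := by rw [map_sub, hDB]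
    _ ≤ ‖D‖ * (C * (‖B‖ * ‖g‖)) := by
      refine (D.le_opNorm _).trans ?_
      gcongr
      refine hup.trans ?_
      gcongr
      exact B.le_opNorm g
    _ = _ := by ring

/-- First order perturbation of an isolated eigenvalue `i ω₀` of the relation `Γ`, which is
skew-symmetric with weight `A`. If, for small `t > 0`, `w t` is an eigenvector of `Γ` perturbed by
`i t A⁻¹ S`, with eigenvalue `i ν t`, and if `S ≤ τ A` as quadratic forms, then `ν' ≤ τ`. -/
theorem deriv_eigenvalue_le (A : H →L[ℂ] H) (hA : IsSelfAdjoint A) {c : ℝ} (hc : 0 < c)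
    (hAc : ∀ x, c * ‖x‖ ^ 2 ≤ (inner ℂ (A x) x).re) (Γ : Submodule ℂ (H × H))
    (skew : ∀ p ∈ Γ, ∀ q ∈ Γ, inner ℂ (A p.2) q.1 = -inner ℂ p.1 (A q.2)) {ω₀ δ : ℝ} (hδ : 0 < δ)
    (hres : ∀ ζ : ℂ, ζ ≠ Complex.I * ω₀ → ‖ζ - Complex.I * ω₀‖ < δ →
      ∀ g : H, ∃! u : H, (u, ζ • u - g) ∈ Γ)
    (S : H →L[ℂ] H) {τ : ℝ} (hS : ∀ x, (inner ℂ (S x) x).re ≤ τ * (inner ℂ (A x) x).re)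
    {ν : ℝ → ℝ} {ν' : ℝ} (hν : HasDerivAt ν ν' 0) (hν0 : ν 0 = ω₀)
    (hw : ∀ᶠ t in nhdsWithin (0 : ℝ) (Ioi 0), ∃ w f : H, w ≠ 0 ∧ (w, f) ∈ Γ ∧
      A f = (Complex.I * ν t) • A w - (Complex.I * t) • S w) : ν' ≤ τ := by
  obtain ⟨C, hC, hker⟩ := exists_near_kernel_weighted A hA hc hAc Γ skew hδ hres
  have hAbd : ∀ x, c * ‖x‖ ≤ ‖A x‖ := by
    intro x
    rcases eq_or_ne x 0 with rfl | hx
    · simp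
    · have h1 := (hAc x).trans ((Complex.re_le_norm _).trans (norm_inner_le_norm (A x) x))
      have h2 : 0 < ‖x‖ := norm_pos_iff.mpr hx
      refine le_of_mul_le_mul_right ?_ h2
      linarith [sq ‖x‖]
  let e : ℝ → ℝ := fun t => C * (|ν t - ω₀| + t * (‖S‖ / c))
  let q : ℝ → ℝ := fun t => (ν t - ω₀) / t
  have hq : Filter.Tendsto q (nhdsWithin 0 (Ioi 0)) (nhds ν') := by
    have := (hasDerivAt_iff_tendsto_slope.mp hν).mono_left
      (nhdsWithin_mono 0 (fun t (ht : 0 < t) => ht.ne'))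
    refine this.congr fun t => ?_
    simp only [slope_def_field, q, hν0, sub_zero]
  have he : Filter.Tendsto e (nhdsWithin 0 (Ioi 0)) (nhds 0) := by
    have h1 : ContinuousAt e 0 := by
      have := hν.continuousAt
      fun_prop
    have h2 : e 0 = 0 := by simp [e, hν0]
    have h3 := h1.tendsto.mono_left (nhdsWithin_le_nhds (s := Ioi 0))
    rwa [h2] at h3
  have hlim : Filter.Tendsto (fun t => τ + (‖S‖ + |q t| * ‖A‖) * e t / c) (nhdsWithin 0 (Ioi 0))
      (nhds (τ + (‖S‖ + |ν'| * ‖A‖) * 0 / c)) :=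
    tendsto_const_nhds.add ((((tendsto_const_nhds.add (hq.abs.mul_const _)).mul he)).div_const c)
  rw [mul_zero, zero_div, add_zero] at hlim
  refine le_of_tendsto_of_tendsto hq hlim ?_
  filter_upwards [hw, self_mem_nhdsWithin] with t ⟨w, f, hw0, hwf, hf⟩ (ht : 0 < t)
  have hwpos : 0 < ‖w‖ := norm_pos_iff.mpr hw0
  -- The defect of `w` as an eigenvector of `Γ` itself.
  set g : H := (Complex.I * ω₀) • w - f with hg
  have hgn : ‖g‖ ≤ (|ν t - ω₀| + t * (‖S‖ / c)) * ‖w‖ := by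
    set k : H := g - (Complex.I * ((ω₀ - ν t : ℝ) : ℂ)) • w with hk
    have h1 : A k = (Complex.I * t) • S w := by
      rw [hk, hg, map_sub, map_sub, map_smul, map_smul, hf]
      push_cast
      module
    have h2 : ‖k‖ ≤ t * (‖S‖ / c) * ‖w‖ := by
      have h3 := hAbd k
      rw [h1, norm_smul, norm_mul, Complex.norm_I, one_mul, Complex.norm_real, Real.norm_eq_abs,
        abs_of_pos ht] at h3
      have h4 := S.le_opNorm w
      rw [← mul_le_mul_iff_right₀ hc]
      calc c * ‖k‖ ≤ t * (‖S‖ * ‖w‖) := h3.trans (by gcongr)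
        _ = _ := by field_simp
    calc ‖g‖ = ‖(Complex.I * ((ω₀ - ν t : ℝ) : ℂ)) • w + k‖ := by rw [hk]; congr 1; abel
      _ ≤ |ν t - ω₀| * ‖w‖ + t * (‖S‖ / c) * ‖w‖ := by
        refine (norm_add_le _ _).trans (add_le_add ?_ h2)
        rw [norm_smul, norm_mul, Complex.norm_I, one_mul, Complex.norm_real, Real.norm_eq_abs,
          abs_sub_comm]
      _ = _ := by ring
  obtain ⟨p, hp, hwp⟩ := hker w g (by rw [hg, sub_sub_cancel]; exact hwf)
  have hwp' : ‖p - w‖ ≤ e t * ‖w‖ := by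
    rw [norm_sub_rev]
    refine hwp.trans ((mul_le_mul_of_nonneg_left hgn hC).trans_eq ?_)
    simp only [e]; ring
  -- The unperturbed eigenvector `p` removes `Γ` from the equation of `w`.
  have key : (q t : ℂ) * inner ℂ (A w) p = inner ℂ (S w) p := by
    have h1 := skew _ hwf _ hp
    simp only [hf, inner_sub_left, inner_smul_left, map_smul, inner_smul_right, map_mul,
      Complex.conj_I, Complex.conj_ofReal] at h1
    rw [show inner ℂ w (A p) = inner ℂ (A w) p from (hA.isSymmetric w p).symm] at h1
    have h2 : Complex.I * (((ν t : ℂ) - ω₀) * inner ℂ (A w) p) =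
        Complex.I * ((t : ℂ) * inner ℂ (S w) p) := by
      linear_combination -h1
    have h3 := mul_left_cancel₀ Complex.I_ne_zero h2
    have h4 : (t : ℂ) ≠ 0 := by exact_mod_cast ht.ne'
    simp only [q]
    push_cast
    rw [div_mul_eq_mul_div, h3]
    field_simp
  have hre := congrArg Complex.re key
  rw [Complex.re_ofReal_mul] at hre
  have hsplit : ∀ T : H →L[ℂ] H,
      |(inner ℂ (T w) p).re - (inner ℂ (T w) w).re| ≤ ‖T‖ * e t * ‖w‖ ^ 2 := by
    intro T
    rw [← Complex.sub_re, ← inner_sub_right]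
    refine (Complex.abs_re_le_norm _).trans ((norm_inner_le_norm _ _).trans ?_)
    calc ‖T w‖ * ‖p - w‖ ≤ (‖T‖ * ‖w‖) * (e t * ‖w‖) := by
          gcongr
          exact T.le_opNorm w
      _ = _ := by ring
  have hcore : (q t - τ) * (inner ℂ (A w) w).re ≤ (‖S‖ + |q t| * ‖A‖) * e t * ‖w‖ ^ 2 := by
    have h1 := (abs_le.mp (hsplit S)).2
    have h2 : |q t * ((inner ℂ (A w) p).re - (inner ℂ (A w) w).re)| ≤
        |q t| * (‖A‖ * e t * ‖w‖ ^ 2) := by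
      rw [abs_mul]
      exact mul_le_mul_of_nonneg_left (hsplit A) (abs_nonneg _)
    have h3 := (abs_le.mp h2).1
    have h4 := hS w
    nlinarith
  rcases le_total (q t) τ with hle | hle
  · have : 0 ≤ e t := by
      by_contra hneg
      nlinarith [norm_nonneg (p - w)]
    exact hle.trans (le_add_of_nonneg_right (by positivity))
  · have h1 := mul_le_mul_of_nonneg_left (hAc w) (sub_nonneg.mpr hle)
    have h2 : (c * (q t - τ)) * ‖w‖ ^ 2 ≤ ((‖S‖ + |q t| * ‖A‖) * e t) * ‖w‖ ^ 2 := by linarith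
    have h3 := le_of_mul_le_mul_right h2 (by positivity)
    rw [← sub_le_iff_le_add', le_div_iff₀ hc]
    linarith

end IsolatedSpectrum

/-! ### Quadratic forms and the speeds of propagation -/

section Speeds

open Matrix

/-- The real symmetric matrix `S(η)` with `G (e^{iη·x} φ) = e^{iη·x} (G φ + i S(η) φ)`. -/
def symbol (η : R3) : Matrix (Fin 3 ⊕ Fin 3) (Fin 3 ⊕ Fin 3) ℝ :=
  Matrix.fromBlocks 0 (wedge η) (-wedge η) 0

theorem charPoly_eq (M : PeriodicMedium) (y : R3) (τ : ℝ) (ξ : R3) :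
    M.charPoly y τ ξ = (τ • M.A0 y - symbol ξ).det := by
  rw [PeriodicMedium.charPoly, symbol, sub_eq_add_neg, Matrix.fromBlocks_neg]
  simp

theorem transpose_wedge (η : R3) : (wedge η)ᵀ = -wedge η := by
  ext i j
  fin_cases i <;> fin_cases j <;> simp [wedge]

theorem transpose_symbol (η : R3) : (symbol η)ᵀ = symbol η := by
  rw [symbol, Matrix.fromBlocks_transpose, Matrix.transpose_neg, transpose_wedge, neg_neg,
    Matrix.transpose_zero]

theorem transpose_A0 (M : PeriodicMedium) (y : R3) : (M.A0 y)ᵀ = M.A0 y := by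
  have h1 : (M.eps y)ᵀ = M.eps y := by
    simpa [Matrix.IsHermitian, Matrix.conjTranspose_eq_transpose_of_trivial] using
      (M.eps_posDef y).isHermitian
  have h2 : (M.mu y)ᵀ = M.mu y := by
    simpa [Matrix.IsHermitian, Matrix.conjTranspose_eq_transpose_of_trivial] using
      (M.mu_posDef y).isHermitian
  rw [PeriodicMedium.A0, Matrix.fromBlocks_transpose, h1, h2, Matrix.transpose_zero]

theorem continuous_A0 (M : PeriodicMedium) : Continuous M.A0 := by
  refine continuous_matrix fun i j => ?_
  rcases i with i | i <;> rcases j with j | j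
  · exact (M.eps_smooth i j).continuous
  · exact continuous_const
  · exact continuous_const
  · exact (M.mu_smooth i j).continuous

theorem isPeriodic_A0 (M : PeriodicMedium) : IsPeriodic M.A0 := fun j x => by
  rw [PeriodicMedium.A0, PeriodicMedium.A0, M.eps_periodic j x, M.mu_periodic j x]

/-- A periodic function takes all its values on the period cell. -/
theorem IsPeriodic.exists_mem_cell {α : Type*} {g : R3 → α} (hg : IsPeriodic g) (y : R3) :
    ∃ x ∈ cell, g x = g y := by
  have hT : (0 : ℝ) < 2 * Real.pi := by positivity
  have hp : ∀ j, Function.Periodic g (EuclideanSpace.single j (2 * Real.pi)) := fun j x => hg j x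
  let n : Fin 3 → ℤ := fun j => toIcoDiv hT 0 (y j)
  refine ⟨y - n 0 • EuclideanSpace.single 0 (2 * Real.pi)
    - n 1 • EuclideanSpace.single 1 (2 * Real.pi)
    - n 2 • EuclideanSpace.single 2 (2 * Real.pi), fun j => ?_, ?_⟩
  · have h := toIcoMod_mem_Ico hT 0 (y j)
    rw [zero_add] at h
    have h2 : toIcoMod hT 0 (y j) = y j - n j • (2 * Real.pi) := rfl
    rw [h2] at h
    fin_cases j <;> simpa using h
  · rw [(hp 2).sub_zsmul_eq, (hp 1).sub_zsmul_eq, (hp 0).sub_zsmul_eq]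

variable {n : Type*} [Fintype n]

theorem isCompact_dotProduct_sphere : IsCompact {x : n → ℝ | x ⬝ᵥ x = 1} := by
  refine Metric.isCompact_of_isClosed_isBounded ?_ ?_
  · exact isClosed_eq (by fun_prop) continuous_const
  · refine (Metric.isBounded_closedBall (x := (0 : n → ℝ)) (r := 1)).subset fun x hx => ?_
    rw [mem_closedBall_zero_iff, pi_norm_le_iff_of_nonneg zero_le_one]
    intro i
    rw [Real.norm_eq_abs, ← sq_le_one_iff_abs_le_one]
    have h : x i * x i ≤ x ⬝ᵥ x :=
      Finset.single_le_sum (f := fun i => x i * x i) (fun i _ => mul_self_nonneg _)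
        (Finset.mem_univ i)
    have h2 : x ⬝ᵥ x = 1 := hx
    nlinarith

theorem quadForm_le_of_sphere (N : Matrix n n ℝ) {k : ℝ}
    (h : ∀ x : n → ℝ, x ⬝ᵥ x = 1 → x ⬝ᵥ N *ᵥ x ≤ k) (x : n → ℝ) :
    x ⬝ᵥ N *ᵥ x ≤ k * (x ⬝ᵥ x) := by
  rcases eq_or_ne x 0 with rfl | hx
  · simp
  · have hpos : 0 < x ⬝ᵥ x := by
      have := Matrix.dotProduct_star_self_pos_iff.mpr hx
      simpa using this
    set r := Real.sqrt (x ⬝ᵥ x)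
    have hr : 0 < r := Real.sqrt_pos.mpr hpos
    have hrr : r * r = x ⬝ᵥ x := Real.mul_self_sqrt hpos.le
    have h1 := h (r⁻¹ • x) (by
      rw [smul_dotProduct, dotProduct_smul, ← hrr]; simp; field_simp)
    rw [Matrix.mulVec_smul, smul_dotProduct, dotProduct_smul, smul_eq_mul, smul_eq_mul] at h1
    rw [← hrr]
    have h2 : x ⬝ᵥ N *ᵥ x = r * r * (r⁻¹ * (r⁻¹ * (x ⬝ᵥ N *ᵥ x))) := by field_simp
    rw [h2, mul_comm k]
    gcongr

theorem exists_quadForm_le (N : Matrix n n ℝ) :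
    ∃ k : ℝ, 0 ≤ k ∧ ∀ x : n → ℝ, x ⬝ᵥ N *ᵥ x ≤ k * (x ⬝ᵥ x) := by
  obtain ⟨k, hk⟩ := isCompact_dotProduct_sphere (n := n) |>.exists_bound_of_continuousOn
    (f := fun x => x ⬝ᵥ N *ᵥ x) (by fun_prop)
  refine ⟨max k 0, le_max_right _ _, quadForm_le_of_sphere N fun x hx => ?_⟩
  exact (le_abs_self _).trans ((hk x hx).trans (le_max_left _ _))

theorem A0_quadForm_pos (M : PeriodicMedium) (y : R3) {x : Fin 3 ⊕ Fin 3 → ℝ} (hx : x ≠ 0) :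
    0 < x ⬝ᵥ M.A0 y *ᵥ x := by
  have h1 : x ⬝ᵥ M.A0 y *ᵥ x = (x ∘ Sum.inl) ⬝ᵥ M.eps y *ᵥ (x ∘ Sum.inl) +
      (x ∘ Sum.inr) ⬝ᵥ M.mu y *ᵥ (x ∘ Sum.inr) := by
    rw [PeriodicMedium.A0, Matrix.fromBlocks_mulVec, Matrix.dotProduct_block]
    simp
  rw [h1]
  by_cases h : x ∘ Sum.inl = 0
  · have h' : x ∘ Sum.inr ≠ 0 := by
      intro h'
      apply hx
      ext (i | i)
      · exact congrFun h i
      · exact congrFun h' i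
    rw [h]
    simpa using (M.mu_posDef y).dotProduct_mulVec_pos h'
  · have h2 := (M.eps_posDef y).dotProduct_mulVec_pos h
    have h3 := (M.mu_posDef y).posSemidef.dotProduct_mulVec_nonneg (x ∘ Sum.inr)
    simp only [star_trivial] at h2 h3
    linarith

/-- `A₀(y)` is positive definite uniformly in `y`, by compactness of the period cell. -/
theorem exists_A0_coercive (M : PeriodicMedium) :
    ∃ c > 0, ∀ (y : R3) (x : Fin 3 ⊕ Fin 3 → ℝ), c * (x ⬝ᵥ x) ≤ x ⬝ᵥ M.A0 y *ᵥ x := by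
  have hK := isBounded_cell.isCompact_closure.prod
    (isCompact_dotProduct_sphere (n := Fin 3 ⊕ Fin 3))
  have hne : (closure cell ×ˢ {x : Fin 3 ⊕ Fin 3 → ℝ | x ⬝ᵥ x = 1}).Nonempty := by
    refine ⟨(0, Pi.single (Sum.inl 0) 1), subset_closure fun i => ?_, by simp⟩
    simp [Real.pi_pos]
  have hcont : Continuous fun p : R3 × (Fin 3 ⊕ Fin 3 → ℝ) => p.2 ⬝ᵥ M.A0 p.1 *ᵥ p.2 := by
    have := (continuous_A0 M).comp (continuous_fst (X := R3) (Y := Fin 3 ⊕ Fin 3 → ℝ))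
    exact continuous_snd.dotProduct (this.matrix_mulVec continuous_snd)
  obtain ⟨⟨y₀, x₀⟩, ⟨-, hx₀⟩, hmin⟩ := hK.exists_isMinOn hne hcont.continuousOn
  refine ⟨x₀ ⬝ᵥ M.A0 y₀ *ᵥ x₀, A0_quadForm_pos M y₀ ?_, fun y x => ?_⟩
  · rintro rfl
    simp at hx₀
  · obtain ⟨y', hy', h⟩ := (isPeriodic_A0 M).exists_mem_cell y
    rw [← h]
    have h1 := quadForm_le_of_sphere (-M.A0 y') (k := -(x₀ ⬝ᵥ M.A0 y₀ *ᵥ x₀)) (fun z hz => by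
      rw [Matrix.neg_mulVec, dotProduct_neg]
      exact neg_le_neg (hmin (a := (y', z)) ⟨subset_closure hy', hz⟩)) x
    rw [Matrix.neg_mulVec, dotProduct_neg] at h1
    linarith

/-- The roots of `p(y, ·, ξ)` are bounded above, uniformly in `y`. -/
theorem exists_charPoly_root_le (M : PeriodicMedium) (ξ : R3) :
    ∃ K, ∀ y τ, M.charPoly y τ ξ = 0 → τ ≤ K := by
  obtain ⟨c, hc, hcoer⟩ := exists_A0_coercive M
  obtain ⟨k, hk, hS⟩ := exists_quadForm_le (symbol ξ)
  refine ⟨k / c, fun y τ hτ => ?_⟩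
  rw [charPoly_eq] at hτ
  obtain ⟨v, hv, hv0⟩ := Matrix.exists_mulVec_eq_zero_iff.mpr hτ
  have h1 : τ * (v ⬝ᵥ M.A0 y *ᵥ v) = v ⬝ᵥ symbol ξ *ᵥ v := by
    have := congrArg (v ⬝ᵥ ·) hv0
    simp only [Matrix.sub_mulVec, Matrix.smul_mulVec, dotProduct_sub, dotProduct_smul,
      dotProduct_zero, smul_eq_mul] at this
    linarith
  have hvv : 0 < v ⬝ᵥ v := by simpa using Matrix.dotProduct_star_self_pos_iff.mpr hv
  rcases le_total τ 0 with h | h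
  · exact h.trans (by positivity)
  · rw [le_div_iff₀ hc]
    refine le_of_mul_le_mul_right ?_ hvv
    have h2 := hS v
    have h3 := mul_le_mul_of_nonneg_left (hcoer y v) h
    linarith

/-- Some root of `p(y, ·, ξ)` dominates the Rayleigh quotient of `S(ξ)` relative to `A₀(y)`,
since the maximum of the quotient is itself a root. -/
theorem exists_root_symbol_le (M : PeriodicMedium) (y ξ : R3) :
    ∃ τ, M.charPoly y τ ξ = 0 ∧ ∀ x : Fin 3 ⊕ Fin 3 → ℝ,
      x ⬝ᵥ symbol ξ *ᵥ x ≤ τ * (x ⬝ᵥ M.A0 y *ᵥ x) := by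
  have hne : {x : Fin 3 ⊕ Fin 3 → ℝ | x ⬝ᵥ x = 1}.Nonempty :=
    ⟨Pi.single (Sum.inl 0) 1, by simp⟩
  have hx0 : ∀ x : Fin 3 ⊕ Fin 3 → ℝ, x ⬝ᵥ x = 1 → x ≠ 0 := by
    rintro x hx rfl
    simp at hx
  obtain ⟨x₀, hx₀, hmax⟩ := (isCompact_dotProduct_sphere (n := Fin 3 ⊕ Fin 3)).exists_isMaxOn hne
    (f := fun x => (x ⬝ᵥ symbol ξ *ᵥ x) / (x ⬝ᵥ M.A0 y *ᵥ x))
    (ContinuousOn.div (by fun_prop) (by fun_prop)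
      fun x hx => (A0_quadForm_pos M y (hx0 x hx)).ne')
  set τ := (x₀ ⬝ᵥ symbol ξ *ᵥ x₀) / (x₀ ⬝ᵥ M.A0 y *ᵥ x₀) with hτ
  have hpos := A0_quadForm_pos M y (hx0 x₀ hx₀)
  have hle : ∀ x : Fin 3 ⊕ Fin 3 → ℝ, 0 ≤ x ⬝ᵥ (τ • M.A0 y - symbol ξ) *ᵥ x := by
    intro x
    have h1 := quadForm_le_of_sphere (-(τ • M.A0 y - symbol ξ)) (k := 0) (fun z hz => by
      have h2 : (z ⬝ᵥ symbol ξ *ᵥ z) / (z ⬝ᵥ M.A0 y *ᵥ z) ≤ τ := hmax hz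
      rw [div_le_iff₀ (A0_quadForm_pos M y (hx0 z hz))] at h2
      rw [Matrix.neg_mulVec, dotProduct_neg, Matrix.sub_mulVec, Matrix.smul_mulVec, dotProduct_sub,
        dotProduct_smul, smul_eq_mul]
      linarith) x
    rw [Matrix.neg_mulVec, dotProduct_neg] at h1
    linarith
  have hpsd : (τ • M.A0 y - symbol ξ).PosSemidef := by
    refine Matrix.PosSemidef.of_dotProduct_mulVec_nonneg ?_ fun x => by simpa using hle x
    rw [Matrix.IsHermitian, Matrix.conjTranspose_eq_transpose_of_trivial, Matrix.transpose_sub,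
      Matrix.transpose_smul, transpose_A0, transpose_symbol]
  have hker : (τ • M.A0 y - symbol ξ) *ᵥ x₀ = 0 := by
    rw [← hpsd.dotProduct_mulVec_zero_iff, star_trivial, Matrix.sub_mulVec, Matrix.smul_mulVec,
      dotProduct_sub, dotProduct_smul, smul_eq_mul, hτ, div_mul_cancel₀ _ hpos.ne', sub_self]
  refine ⟨τ, ?_, fun x => ?_⟩
  · rw [charPoly_eq]
    exact Matrix.exists_mulVec_eq_zero_iff.mp ⟨x₀, hx0 x₀ hx₀, hker⟩
  · have := hle x
    rw [Matrix.sub_mulVec, Matrix.smul_mulVec, dotProduct_sub, dotProduct_smul, smul_eq_mul] at this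
    linarith

/-- `S(ξ) ≤ τ_max(ξ) A₀(y)` as quadratic forms. The uniform bound on the roots ensures that the
suprema defining `τ_max` are not those of unbounded sets. -/
theorem symbol_le_tauMax (M : PeriodicMedium) (y ξ : R3) (x : Fin 3 ⊕ Fin 3 → ℝ) :
    x ⬝ᵥ symbol ξ *ᵥ x ≤ M.tauMax ξ * (x ⬝ᵥ M.A0 y *ᵥ x) := by
  obtain ⟨K, hK⟩ := exists_charPoly_root_le M ξ
  obtain ⟨τ, hτ, h⟩ := exists_root_symbol_le M y ξ
  have h1 : τ ≤ M.tauMaxAt y ξ := le_csSup ⟨K, fun σ hσ => hK y σ hσ⟩ hτ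
  have h2 : M.tauMaxAt y ξ ≤ M.tauMax ξ := by
    refine le_csSup ⟨K, ?_⟩ ⟨y, rfl⟩
    rintro _ ⟨z, rfl⟩
    obtain ⟨σ, hσ, -⟩ := exists_root_symbol_le M z ξ
    exact csSup_le ⟨σ, hσ⟩ fun ρ hρ => hK z ρ hρ
  have h3 : 0 ≤ x ⬝ᵥ M.A0 y *ᵥ x := by
    rcases eq_or_ne x 0 with rfl | hx
    · simp
    · exact (A0_quadForm_pos M y hx).le
  exact (h x).trans (mul_le_mul_of_nonneg_right (h1.trans h2) h3)

/-- The complex quadratic form of a real matrix is the sum of its values on real and imaginary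
parts. -/
theorem re_inner_toEuclideanCLM [DecidableEq n] (N : Matrix n n ℝ) (x : EuclideanSpace ℂ n) :
    (inner ℂ (Matrix.toEuclideanCLM (𝕜 := ℂ) (N.map fun r : ℝ => (r : ℂ)) x) x).re =
      (fun i => (x i).re) ⬝ᵥ N *ᵥ (fun i => (x i).re) +
      (fun i => (x i).im) ⬝ᵥ N *ᵥ (fun i => (x i).im) := by
  have h : ∀ i, (Matrix.toEuclideanCLM (𝕜 := ℂ) (N.map fun r : ℝ => (r : ℂ)) x) i =
      ⟨(N *ᵥ fun i => (x i).re) i, (N *ᵥ fun i => (x i).im) i⟩ := by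
    intro i
    rw [Matrix.ofLp_toEuclideanCLM]
    apply Complex.ext <;> simp [Matrix.mulVec, dotProduct]
  rw [PiLp.inner_apply, Complex.re_sum]
  simp only [dotProduct, ← Finset.sum_add_distrib]
  refine Finset.sum_congr rfl fun i _ => ?_
  rw [h i]
  simp [RCLike.inner_apply]

/-- `S(η)` as a linear map of `ℂ³ × ℂ³`. -/
def symbolC (η : R3) : C6 →L[ℂ] C6 :=
  Matrix.toEuclideanCLM (𝕜 := ℂ) ((symbol η).map fun r : ℝ => (r : ℂ))

theorem re_inner_symbolC_le (M : PeriodicMedium) (y ξ : R3) (x : C6) :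
    (inner ℂ (symbolC ξ x) x).re ≤ M.tauMax ξ * (inner ℂ (M.A0C y x) x).re := by
  rw [symbolC, PeriodicMedium.A0C, re_inner_toEuclideanCLM, re_inner_toEuclideanCLM, mul_add]
  exact add_le_add (symbol_le_tauMax M y ξ _) (symbol_le_tauMax M y ξ _)

theorem exists_A0C_coercive (M : PeriodicMedium) :
    ∃ c > 0, ∀ (y : R3) (x : C6), c * ‖x‖ ^ 2 ≤ (inner ℂ (M.A0C y x) x).re := by
  obtain ⟨c, hc, h⟩ := exists_A0_coercive M
  refine ⟨c, hc, fun y x => ?_⟩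
  rw [PeriodicMedium.A0C, re_inner_toEuclideanCLM]
  refine le_trans (le_of_eq ?_) (add_le_add (h y _) (h y _))
  rw [← mul_add, EuclideanSpace.norm_sq_eq]
  simp only [dotProduct, ← Finset.sum_add_distrib]
  congr 1
  refine Finset.sum_congr rfl fun i _ => ?_
  rw [← Complex.normSq_eq_norm_sq, Complex.normSq_apply]

theorem inner_toEuclideanCLM_of_symm [DecidableEq n] {N : Matrix n n ℝ} (hN : Nᵀ = N)
    (x y : EuclideanSpace ℂ n) :
    inner ℂ (Matrix.toEuclideanCLM (𝕜 := ℂ) (N.map fun r : ℝ => (r : ℂ)) x) y =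
      inner ℂ x (Matrix.toEuclideanCLM (𝕜 := ℂ) (N.map fun r : ℝ => (r : ℂ)) y) := by
  have h : IsSelfAdjoint (N.map fun r : ℝ => (r : ℂ)) := by
    rw [IsSelfAdjoint, Matrix.star_eq_conjTranspose]
    ext i j
    have hij : N j i = N i j := congrFun (congrFun hN i) j
    simp [hij]
  exact (h.map (Matrix.toEuclideanCLM (n := n) (𝕜 := ℂ))).isSymmetric x y

theorem inner_A0C (M : PeriodicMedium) (y : R3) (u v : C6) :
    inner ℂ (M.A0C y u) v = inner ℂ u (M.A0C y v) :=
  inner_toEuclideanCLM_of_symm (transpose_A0 M y) u v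

theorem inner_symbolC (η : R3) (u v : C6) :
    inner ℂ (symbolC η u) v = inner ℂ u (symbolC η v) :=
  inner_toEuclideanCLM_of_symm (transpose_symbol η) u v

end Speeds

/-! ### Fourier series on the period cell -/

section Fourier

/-- The Haar probability measure on the three-dimensional torus `(ℝ/ℤ)³`. -/
abbrev torusMeasure : Measure (UnitAddTorus (Fin 3)) :=
  Measure.pi fun _ => AddCircle.haarAddCircle

/-- The representative in `]0, 2π]³` of a point of the torus `(ℝ/ℤ)³`, rescaled by `2π`. -/
def cellPoint (t : UnitAddTorus (Fin 3)) : R3 :=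
  WithLp.toLp 2 fun i => (2 * Real.pi) * (AddCircle.equivIoc (1 : ℝ) 0 (t i) : ℝ)

theorem measurableSet_cell : MeasurableSet cell := by
  have : cell = ⋂ i, (fun x : R3 => x i) ⁻¹' Ico 0 (2 * Real.pi) := by
    ext x; simp [cell]
  rw [this]
  exact MeasurableSet.iInter fun i => measurableSet_Ico.preimage (by fun_prop)

instance isFiniteMeasure_cell : IsFiniteMeasure (volume.restrict cell : Measure R3) :=
  ⟨by simpa using isBounded_cell.measure_lt_top⟩

theorem exists_measurePreserving_cellPoint : ∃ c : ENNReal, c ≠ 0 ∧ c ≠ ⊤ ∧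
    MeasurePreserving cellPoint torusMeasure (c • (volume.restrict cell : Measure R3)) := by
  have hπ : (2 * Real.pi) ≠ 0 := by positivity
  let box : Set (Fin 3 → ℝ) := {x | ∀ i, x i ∈ Ioc (0 : ℝ) (0 + 1)}
  let box' : Set (Fin 3 → ℝ) := {x | ∀ i, x i ∈ Ioc (0 : ℝ) (2 * Real.pi)}
  have hbox : MeasurableSet box := MeasurableSet.univ_pi' fun i => measurableSet_Ioc
  have hbox' : MeasurableSet box' := MeasurableSet.univ_pi' fun i => measurableSet_Ioc
  -- `cellPoint` is the identification of the torus with `]0, 1]³`, followed by the dilation by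
  -- `2π`; the half-open boxes `]0, 2π]³` and `[0, 2π[³` differ by a null set.
  have h1 : MeasurePreserving (fun t : UnitAddTorus (Fin 3) => fun i =>
      (AddCircle.equivIoc (1 : ℝ) 0 (t i) : ℝ)) torusMeasure (volume.restrict box) :=
    (measurePreserving_subtype_coe hbox).comp
      (UnitAddTorus.measurePreserving_equivPiIoc (fun _ : Fin 3 => (0 : ℝ)))
  let c : ENNReal := ENNReal.ofReal |((2 * Real.pi) ^ Module.finrank ℝ (Fin 3 → ℝ))⁻¹|
  have h2 : MeasurePreserving (fun x : Fin 3 → ℝ => (2 * Real.pi) • x) volume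
      (c • (volume : Measure (Fin 3 → ℝ))) :=
    ⟨by fun_prop, Measure.map_addHaar_smul volume hπ⟩
  have h3 : MeasurePreserving (fun x : Fin 3 → ℝ => (2 * Real.pi) • x) (volume.restrict box)
      (c • (volume.restrict box' : Measure (Fin 3 → ℝ))) := by
    have h := h2.restrict_preimage hbox'
    rw [Measure.restrict_smul] at h
    convert h using 2
    ext x
    have hp : 0 < 2 * Real.pi := by positivity
    refine forall_congr' fun i => ?_
    simp only [mem_Ioc, Pi.smul_apply, smul_eq_mul, zero_add, mul_pos_iff_of_pos_left hp,
      mul_le_iff_le_one_right hp]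
  have h4 : MeasurePreserving (WithLp.toLp 2 : (Fin 3 → ℝ) → R3) (volume.restrict box')
      (volume.restrict cell) := by
    have h := (PiLp.volume_preserving_toLp (Fin 3)).restrict_preimage measurableSet_cell
    have e1 := Measure.univ_pi_Ioc_ae_eq_Icc (μ := fun _ : Fin 3 => (volume : Measure ℝ))
      (f := fun _ => 0) (g := fun _ => 2 * Real.pi)
    have e2 := Measure.univ_pi_Ico_ae_eq_Icc (μ := fun _ : Fin 3 => (volume : Measure ℝ))
      (f := fun _ => 0) (g := fun _ => 2 * Real.pi)
    have e3 : box' = Set.univ.pi fun _ => Ioc 0 (2 * Real.pi) := by ext; simp [box']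
    have e4 : (WithLp.toLp 2 : (Fin 3 → ℝ) → R3) ⁻¹' cell =
        Set.univ.pi fun _ => Ico 0 (2 * Real.pi) := by ext; simp [cell]
    have e5 : (volume : Measure (Fin 3 → ℝ)).restrict (Set.univ.pi fun _ => Ioc 0 (2 * Real.pi)) =
        volume.restrict (Set.univ.pi fun _ => Ico 0 (2 * Real.pi)) :=
      Measure.restrict_congr_set (e1.trans e2.symm)
    rwa [e4, ← e5, ← e3] at h
  have h5 : MeasurePreserving (WithLp.toLp 2 : (Fin 3 → ℝ) → R3) (c • volume.restrict box')
      (c • (volume.restrict cell : Measure R3)) :=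
    ⟨h4.measurable, by rw [Measure.map_smul, h4.map_eq]⟩
  refine ⟨c, ?_, ENNReal.ofReal_ne_top, h5.comp (h3.comp h1)⟩
  rw [ENNReal.ofReal_ne_zero_iff]
  positivity

/-- The plane wave `x ↦ e^{iη·x}`. -/
def wave (η x : R3) : ℂ := Complex.exp (Complex.I * ((inner ℝ η x : ℝ) : ℂ))

theorem wave_add (η ζ x : R3) : wave (η + ζ) x = wave η x * wave ζ x := by
  rw [wave, wave, wave, ← Complex.exp_add, inner_add_left]
  push_cast; ring_nf

theorem wave_zero (x : R3) : wave 0 x = 1 := by simp [wave]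

theorem wave_neg_mul (η x : R3) : wave (-η) x * wave η x = 1 := by
  rw [← wave_add, neg_add_cancel, wave_zero]

theorem conj_wave (η x : R3) : (starRingEnd ℂ) (wave η x) = wave (-η) x := by
  rw [wave, wave, ← Complex.exp_conj, map_mul, Complex.conj_I, Complex.conj_ofReal, inner_neg_left]
  push_cast; ring_nf

theorem norm_wave (η x : R3) : ‖wave η x‖ = 1 := by
  rw [wave, mul_comm, Complex.norm_exp_ofReal_mul_I]

theorem contDiff_wave (η : R3) : ContDiff ℝ (⊤ : ℕ∞) (wave η) := by
  unfold wave
  have : ContDiff ℝ (⊤ : ℕ∞) fun x : R3 => ((inner ℝ η x : ℝ) : ℂ) :=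
    Complex.ofRealCLM.contDiff.comp (contDiff_const.inner ℝ contDiff_id)
  exact (contDiff_const.mul this).cexp

/-- The lattice frequency with integer coordinates `k`. -/
def freq (k : Fin 3 → ℤ) : R3 := WithLp.toLp 2 fun i => (k i : ℝ)

theorem inner_eq_sum (x y : R3) : inner ℝ x y = ∑ i, x i * y i := by
  rw [PiLp.inner_apply]
  exact Finset.sum_congr rfl fun i _ => by simp [mul_comm]

theorem mFourier_cellPoint (k : Fin 3 → ℤ) (t : UnitAddTorus (Fin 3)) :
    UnitAddTorus.mFourier (-k) t = wave (-freq k) (cellPoint t) := by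
  have h : ∀ i, fourier ((-k) i) (t i) =
      Complex.exp (-(Complex.I * ((k i : ℂ) * ((cellPoint t i : ℝ) : ℂ)))) := by
    intro i
    conv_lhs => rw [← AddCircle.coe_equivIoc (p := (1 : ℝ)) (a := 0) (y := t i)]
    rw [fourier_coe_apply]
    congr 1
    simp only [cellPoint, Pi.neg_apply]
    push_cast; ring
  change ∏ i, fourier ((-k) i) (t i) = _
  rw [Finset.prod_congr rfl fun i _ => h i, ← Complex.exp_sum, wave, inner_neg_left, inner_eq_sum,
    Finset.sum_neg_distrib, ← Finset.mul_sum]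
  simp [freq]

/-- Parseval's identity on the period cell, up to the normalising factor `C`. -/
theorem hasSum_fourier_cell : ∃ C : ℂ, C ≠ 0 ∧ ∀ a b : R3 → ℂ,
    MemLp a 2 (volume.restrict cell) → MemLp b 2 (volume.restrict cell) →
    HasSum (fun k : Fin 3 → ℤ =>
      (starRingEnd ℂ) (∫ x in cell, wave (-freq k) x * a x) * ∫ x in cell, wave (-freq k) x * b x)
      (C * ∫ x in cell, (starRingEnd ℂ) (a x) * b x) := by
  obtain ⟨c, hc0, hct, hΨ⟩ := exists_measurePreserving_cellPoint
  have hr : c.toReal ≠ 0 := ENNReal.toReal_ne_zero.mpr ⟨hc0, hct⟩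
  have hr' : (c.toReal : ℂ) ≠ 0 := by exact_mod_cast hr
  have hint : ∀ g : R3 → ℂ, AEStronglyMeasurable g (volume.restrict cell) →
      ∫ t, g (cellPoint t) ∂torusMeasure = c.toReal * ∫ x in cell, g x := by
    intro g hg
    rw [← integral_map (μ := torusMeasure) (φ := cellPoint) hΨ.measurable.aemeasurable
      (by rw [hΨ.map_eq]; exact hg.smul_measure c), hΨ.map_eq, integral_smul_measure]
    rfl
  refine ⟨(c.toReal : ℂ)⁻¹, inv_ne_zero hr', fun a b ha hb => ?_⟩
  have hA := (ha.smul_measure hct).comp_measurePreserving hΨ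
  have hB := (hb.smul_measure hct).comp_measurePreserving hΨ
  have hcoef : ∀ (g : R3 → ℂ) (hg : MemLp g 2 (volume.restrict cell))
      (hG : MemLp (g ∘ cellPoint) 2 torusMeasure) (k : Fin 3 → ℤ),
      UnitAddTorus.mFourierCoeff (hG.toLp (g ∘ cellPoint)) k =
        c.toReal * ∫ x in cell, wave (-freq k) x * g x := by
    intro g hg hG k
    rw [← hint (fun x => wave (-freq k) x * g x)
      ((contDiff_wave _).continuous.aestronglyMeasurable.mul hg.1)]
    refine integral_congr_ae ?_
    filter_upwards [hG.coeFn_toLp] with t ht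
    rw [ht, mFourier_cellPoint, smul_eq_mul]
    rfl
  have h : HasSum (fun k : Fin 3 → ℤ =>
      (starRingEnd ℂ) (UnitAddTorus.mFourierCoeff (hA.toLp (a ∘ cellPoint)) k) *
        UnitAddTorus.mFourierCoeff (hB.toLp (b ∘ cellPoint)) k)
      (∫ t, (starRingEnd ℂ) (hA.toLp (a ∘ cellPoint) t) * hB.toLp (b ∘ cellPoint) t
        ∂torusMeasure) :=
    UnitAddTorus.hasSum_prod_mFourierCoeff _ _
  have h2 : ∫ t, (starRingEnd ℂ) (hA.toLp (a ∘ cellPoint) t) * hB.toLp (b ∘ cellPoint) t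
      ∂torusMeasure = c.toReal * ∫ x in cell, (starRingEnd ℂ) (a x) * b x := by
    rw [← hint (fun x => (starRingEnd ℂ) (a x) * b x)
      ((Complex.continuous_conj.comp_aestronglyMeasurable ha.1).mul hb.1)]
    refine integral_congr_ae ?_
    filter_upwards [hA.coeFn_toLp, hB.coeFn_toLp] with t h1 h2
    rw [h1, h2]
    rfl
  rw [h2] at h
  have h3 := h.mul_left ((c.toReal : ℂ)⁻¹ * (c.toReal : ℂ)⁻¹)
  have e1 : (c.toReal : ℂ)⁻¹ * (c.toReal : ℂ)⁻¹ *
      (c.toReal * ∫ x in cell, (starRingEnd ℂ) (a x) * b x) =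
      (c.toReal : ℂ)⁻¹ * ∫ x in cell, (starRingEnd ℂ) (a x) * b x := by field_simp
  rw [e1] at h3
  refine h3.congr_fun fun k => ?_
  rw [hcoef a ha hA k, hcoef b hb hB k, map_mul, Complex.conj_ofReal]
  field_simp

/-- The Fourier coefficient of `u`, as a `θ`-periodic field, at the frequency `θ + k`. -/
def coef (θ : R3) (u : L2cell) (k : Fin 3 → ℤ) : C6 :=
  ∫ x in cell, wave (-(θ + freq k)) x • u x

theorem integrable_wave_smul (η : R3) (u : L2cell) :
    Integrable (fun x => wave η x • u x) (volume.restrict cell) := by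
  have hu : Integrable u (volume.restrict cell) := (Lp.memLp u).integrable (by norm_num)
  refine hu.mono ((contDiff_wave η).continuous.aestronglyMeasurable.smul hu.1) ?_
  exact Filter.Eventually.of_forall fun x => by rw [norm_smul, norm_wave, one_mul]

/-- Parseval's identity for `θ`-periodic fields. -/
theorem hasSum_inner_coef : ∃ C : ℂ, C ≠ 0 ∧ ∀ (θ : R3) (u v : L2cell),
    HasSum (fun k => inner ℂ (coef θ u k) (coef θ v k)) (C * inner ℂ u v) := by
  obtain ⟨C, hC, h⟩ := hasSum_fourier_cell
  refine ⟨C, hC, fun θ u v => ?_⟩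
  have hmem : ∀ (w : L2cell) j, MemLp (fun x => wave (-θ) x * w x j) 2 (volume.restrict cell) := by
    intro w j
    have hw := (Lp.memLp w).eval_piLp j
    refine hw.of_le ((contDiff_wave _).continuous.aestronglyMeasurable.mul hw.1) ?_
    exact Filter.Eventually.of_forall fun x => by rw [norm_mul, norm_wave, one_mul]
  have hco : ∀ (w : L2cell) k j,
      coef θ w k j = ∫ x in cell, wave (-freq k) x * (wave (-θ) x * w x j) := by
    intro w k j
    have := (EuclideanSpace.proj (𝕜 := ℂ) (ι := Fin 3 ⊕ Fin 3) j).integral_comp_comm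
      (integrable_wave_smul (-(θ + freq k)) w)
    rw [coef]
    refine Eq.trans this.symm (integral_congr_ae (Filter.Eventually.of_forall fun x => ?_))
    change wave (-(θ + freq k)) x * w x j = _
    rw [neg_add, wave_add]; ring
  have hsum := hasSum_sum (s := Finset.univ)
    fun (j : Fin 3 ⊕ Fin 3) _ => h _ _ (hmem u j) (hmem v j)
  convert hsum using 1
  · funext k
    rw [PiLp.inner_apply]
    refine Finset.sum_congr rfl fun j _ => ?_
    rw [hco, hco, RCLike.inner_apply, mul_comm]
  · have hin : ∀ j, Integrable (fun x => (starRingEnd ℂ) (wave (-θ) x * u x j) *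
        (wave (-θ) x * v x j)) (volume.restrict cell) := fun j =>
      (hmem u j).star.integrable_mul (hmem v j)
    rw [← Finset.mul_sum, ← integral_finsetSum _ fun j _ => hin j, L2.inner_def]
    congr 1
    refine integral_congr_ae (Filter.Eventually.of_forall fun x => ?_)
    simp only [PiLp.inner_apply, RCLike.inner_apply]
    refine Finset.sum_congr rfl fun j _ => ?_
    rw [map_mul, conj_wave, neg_neg]
    linear_combination (-(starRingEnd ℂ) (u x j) * v x j) * wave_neg_mul θ x

end Fourier

/-! ### The Maxwell operator in `L²` of the cell -/

section Multiplication

theorem exists_norm_le_on_cell {L : R3 → C6 →L[ℂ] C6} (hL : Continuous L) :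
    ∃ C : ℝ, ∀ x ∈ cell, ‖L x‖ ≤ C := by
  obtain ⟨C, hC⟩ := isBounded_cell.isCompact_closure.exists_bound_of_continuousOn hL.continuousOn
  exact ⟨C, fun x hx => hC x (subset_closure hx)⟩

theorem memLp_clm_apply {L : R3 → C6 →L[ℂ] C6} (hL : Continuous L) (u : L2cell) :
    MemLp (fun x => L x (u x)) 2 (volume.restrict cell) := by
  obtain ⟨C, hC⟩ := exists_norm_le_on_cell hL
  refine (Lp.memLp u).of_le_mul (c := C) ?_ ?_
  · exact (isBoundedBilinearMap_apply (𝕜 := ℂ) (E := C6) (F := C6)).continuous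
      |>.comp_aestronglyMeasurable (hL.aestronglyMeasurable.prodMk (Lp.memLp u).1)
  · filter_upwards [ae_restrict_mem measurableSet_cell] with x hx
    exact (ContinuousLinearMap.le_opNorm _ _).trans
      (mul_le_mul_of_nonneg_right (hC x hx) (norm_nonneg _))

/-- Multiplication by a continuous field of linear maps, as a bounded operator on
`L²(𝕋³_θ)`. -/
def mulL2 (L : R3 → C6 →L[ℂ] C6) (hL : Continuous L) : L2cell →L[ℂ] L2cell :=
  LinearMap.mkContinuousOfExistsBound
    { toFun := fun u => (memLp_clm_apply hL u).toLp _
      map_add' := fun u v => by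
        apply Lp.ext
        filter_upwards [(memLp_clm_apply hL (u + v)).coeFn_toLp, (memLp_clm_apply hL u).coeFn_toLp,
          (memLp_clm_apply hL v).coeFn_toLp, Lp.coeFn_add u v,
          Lp.coeFn_add ((memLp_clm_apply hL u).toLp _) ((memLp_clm_apply hL v).toLp _)]
          with x h1 h2 h3 h4 h5
        rw [h1, h5, Pi.add_apply, h2, h3, h4, Pi.add_apply, map_add]
      map_smul' := fun c u => by
        apply Lp.ext
        filter_upwards [(memLp_clm_apply hL (c • u)).coeFn_toLp, (memLp_clm_apply hL u).coeFn_toLp,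
          Lp.coeFn_smul c u, Lp.coeFn_smul c ((memLp_clm_apply hL u).toLp _)]
          with x h1 h2 h3 h4
        rw [h1, RingHom.id_apply, h4, Pi.smul_apply, h2, h3, Pi.smul_apply, map_smul] }
    (by
      obtain ⟨C, hC⟩ := exists_norm_le_on_cell hL
      refine ⟨C, fun u => Lp.norm_le_mul_norm_of_ae_le_mul ?_⟩
      filter_upwards [(memLp_clm_apply hL u).coeFn_toLp, ae_restrict_mem measurableSet_cell]
        with x h1 hx
      change ‖(memLp_clm_apply hL u).toLp _ x‖ ≤ _
      rw [h1]
      exact (ContinuousLinearMap.le_opNorm _ _).trans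
        (mul_le_mul_of_nonneg_right (hC x hx) (norm_nonneg _)))

theorem coeFn_mulL2 {L : R3 → C6 →L[ℂ] C6} (hL : Continuous L) (u : L2cell) :
    mulL2 L hL u =ᵐ[volume.restrict cell] fun x => L x (u x) :=
  (memLp_clm_apply hL u).coeFn_toLp

theorem isSelfAdjoint_mulL2 {L : R3 → C6 →L[ℂ] C6} (hL : Continuous L)
    (h : ∀ x u v, inner ℂ (L x u) v = inner ℂ u (L x v)) : IsSelfAdjoint (mulL2 L hL) := by
  rw [ContinuousLinearMap.isSelfAdjoint_iff_isSymmetric]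
  intro u v
  change inner ℂ (mulL2 L hL u) v = inner ℂ u (mulL2 L hL v)
  rw [L2.inner_def, L2.inner_def]
  refine integral_congr_ae ?_
  filter_upwards [coeFn_mulL2 hL u, coeFn_mulL2 hL v] with x h1 h2
  rw [h1, h2, h]

theorem re_inner_L2 (u v : L2cell) :
    (inner ℂ u v).re = ∫ x in cell, (inner ℂ (u x) (v x)).re := by
  rw [L2.inner_def]
  exact (integral_re (L2.integrable_inner (𝕜 := ℂ) u v)).symm

theorem integrable_re_inner_L2 (u v : L2cell) :
    Integrable (fun x => (inner ℂ (u x) (v x)).re) (volume.restrict cell) :=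
  (L2.integrable_inner (𝕜 := ℂ) u v).re

theorem re_inner_mulL2_le {L K : R3 → C6 →L[ℂ] C6} (hL : Continuous L) (hK : Continuous K) {τ : ℝ}
    (h : ∀ x u, (inner ℂ (L x u) u).re ≤ τ * (inner ℂ (K x u) u).re) (u : L2cell) :
    (inner ℂ (mulL2 L hL u) u).re ≤ τ * (inner ℂ (mulL2 K hK u) u).re := by
  rw [re_inner_L2, re_inner_L2, ← integral_const_mul]
  refine integral_mono_ae (integrable_re_inner_L2 _ _) ((integrable_re_inner_L2 _ _).const_mul τ) ?_
  filter_upwards [coeFn_mulL2 hL u, coeFn_mulL2 hK u] with x h1 h2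
  rw [h1, h2]
  exact h x (u x)

/-- Multiplication by `A₀` on `L²(𝕋³_θ)`. -/
def weightOp (M : PeriodicMedium) : L2cell →L[ℂ] L2cell := mulL2 M.A0C M.continuous_A0C

theorem isSelfAdjoint_weightOp (M : PeriodicMedium) : IsSelfAdjoint (weightOp M) :=
  isSelfAdjoint_mulL2 _ (inner_A0C M)

theorem exists_weightOp_coercive (M : PeriodicMedium) :
    ∃ c > 0, ∀ u : L2cell, c * ‖u‖ ^ 2 ≤ (inner ℂ (weightOp M u) u).re := by
  obtain ⟨c, hc, h⟩ := exists_A0C_coercive M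
  refine ⟨c, hc, fun u => ?_⟩
  have h0 : ‖u‖ ^ 2 = (inner ℂ u u).re := by
    rw [inner_self_eq_norm_sq_to_K]; norm_cast
  rw [h0, re_inner_L2, weightOp, re_inner_L2, ← integral_const_mul]
  refine integral_mono_ae ((integrable_re_inner_L2 _ _).const_mul c) (integrable_re_inner_L2 _ _) ?_
  filter_upwards [coeFn_mulL2 M.continuous_A0C u] with x h1
  rw [h1]
  refine le_trans (le_of_eq ?_) (h x (u x))
  rw [inner_self_eq_norm_sq_to_K]; norm_cast

theorem surjective_weightOp (M : PeriodicMedium) : Function.Surjective (weightOp M) := by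
  obtain ⟨c, hc, h⟩ := exists_weightOp_coercive M
  have hu : IsUnit (weightOp M) := by
    refine (weightOp M).isUnit_of_forall_le_norm_inner_map (c := ⟨c, hc.le⟩) hc fun x => ?_
    rw [mul_comm]
    exact (h x).trans (Complex.re_le_norm _)
  exact (ContinuousLinearMap.isUnit_iff_bijective.mp hu).2

end Multiplication

section Waves

theorem pd_wave_mul (η : R3) (j : Fin 3) {f : R3 → ℂ} {x : R3} (hf : DifferentiableAt ℝ f x) :
    pd j (fun y => wave η y * f y) x = wave η x * (pd j f x + Complex.I * η j * f x) := by
  have h1 : HasFDerivAt (fun y : R3 => Complex.I * ((inner ℝ η y : ℝ) : ℂ))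
      (Complex.I • (Complex.ofRealCLM.comp (innerSL ℝ η))) x :=
    ((Complex.ofRealCLM.comp (innerSL ℝ η)).hasFDerivAt).const_mul Complex.I
  have h2 : HasFDerivAt (wave η) (wave η x • (Complex.I • (Complex.ofRealCLM.comp (innerSL ℝ η))))
      x := h1.cexp
  have h3 := (h2.mul hf.hasFDerivAt).fderiv
  rw [pd]
  change fderiv ℝ (wave η * f) x _ = _
  rw [h3]
  have h4 : inner ℝ η (EuclideanSpace.single j (1 : ℝ)) = η j := by
    rw [EuclideanSpace.inner_single_right]; simp
  simp [pd, h4]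
  ring

theorem maxwellG_wave_smul (η : R3) {φ : R3 → C6} (hφ : Differentiable ℝ φ) (x : R3) :
    maxwellG (fun y => wave η y • φ y) x =
      wave η x • (maxwellG φ x + Complex.I • symbolC η (φ x)) := by
  have hd : ∀ i, DifferentiableAt ℝ (fun y => φ y i) x := fun i =>
    ((EuclideanSpace.proj (𝕜 := ℂ) (ι := Fin 3 ⊕ Fin 3) i).restrictScalars
      ℝ).differentiableAt.comp x (hφ x)
  have hp : ∀ j i, pd j (fun y => wave η y * φ y i) x =
      wave η x * (pd j (fun y => φ y i) x + Complex.I * η j * φ x i) := fun j i =>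
    pd_wave_mul η j (hd i)
  ext i
  rcases i with i | i <;> fin_cases i <;>
    simp [maxwellG, curl, hp, symbolC, symbol, wedge, Matrix.mulVec, dotProduct,
      Fin.sum_univ_three] <;> ring

theorem maxwellG_const (a : C6) (x : R3) : maxwellG (fun _ => a) x = 0 := by
  ext i
  rcases i with i | i <;> fin_cases i <;> simp [maxwellG, curl, pd]

theorem isThetaPeriodic_iff (θ : R3) (g : R3 → C6) :
    IsThetaPeriodic θ g ↔ IsPeriodic fun x => wave (-θ) x • g x := by
  have : (fun x => Complex.exp (-(Complex.I * ((inner ℝ θ x : ℝ) : ℂ))) • g x) =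
      fun x => wave (-θ) x • g x := by
    funext x
    rw [wave, inner_neg_left]
    push_cast
    rw [mul_neg]
  rw [IsThetaPeriodic, this]

theorem isPeriodic_wave_freq (k : Fin 3 → ℤ) : IsPeriodic (wave (freq k)) := by
  intro j x
  rw [wave, wave, inner_add_right, EuclideanSpace.inner_single_right]
  have h : Complex.exp (Complex.I * (((2 * Real.pi) * (k j : ℝ) : ℝ) : ℂ)) = 1 := by
    rw [← Complex.exp_int_mul_two_pi_mul_I (k j)]
    push_cast; ring_nf
  have h2 : freq k j = (k j : ℝ) := rfl
  simp only [conj_trivial, h2]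
  rw [Complex.ofReal_add, mul_add, Complex.exp_add, h, mul_one]

theorem IsTest.wave_smul {θ : R3} {φ : R3 → C6} (h : IsTest θ φ) (ζ : R3) :
    IsTest (θ + ζ) fun x => wave ζ x • φ x := by
  refine ⟨(contDiff_wave ζ).smul h.1, ?_⟩
  have h2 := h.2
  rw [isThetaPeriodic_iff] at h2 ⊢
  convert h2 using 2 with x
  rw [smul_smul, ← wave_add]
  congr 2; abel

theorem isTest_wave_freq (θ : R3) (k : Fin 3 → ℤ) (a : C6) :
    IsTest θ fun x => wave (θ + freq k) x • a := by
  have h : IsTest 0 fun x => wave (freq k) x • a := by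
    refine ⟨(contDiff_wave _).smul contDiff_const, ?_⟩
    rw [isThetaPeriodic_iff]
    intro j x
    simp only [neg_zero, wave_zero, isPeriodic_wave_freq k j x]
  have h2 := h.wave_smul θ
  rw [zero_add] at h2
  simpa only [smul_smul, ← wave_add] using h2

theorem inner_wave_smul_left (η x : R3) (a b : C6) :
    inner ℂ (wave η x • a) b = inner ℂ a (wave (-η) x • b) := by
  rw [inner_smul_left, inner_smul_right, conj_wave]

end Waves

section Graph

variable {M : PeriodicMedium} {θ : R3}

theorem integral_inner_weightOp (φ : R3 → C6) (f : L2cell) :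
    ∫ x in cell, inner ℂ (φ x) (M.A0C x (f x)) = ∫ x in cell, inner ℂ (φ x) (weightOp M f x) := by
  refine integral_congr_ae ?_
  filter_upwards [coeFn_mulL2 M.continuous_A0C f] with x h
  rw [weightOp, h]

/-- On Fourier coefficients the relation `G u = A₀ f` becomes multiplication by the symbol. -/
theorem PeriodicMedium.InGraph.coef_eq {u f : L2cell} (h : M.InGraph θ u f) (k : Fin 3 → ℤ) :
    coef θ (weightOp M f) k = Complex.I • symbolC (θ + freq k) (coef θ u k) := by
  refine ext_inner_left ℂ fun a => ?_
  have h1 := h _ (isTest_wave_freq θ k a)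
  rw [integral_inner_weightOp] at h1
  have h2 : ∀ x, maxwellG (fun x => wave (θ + freq k) x • a) x =
      wave (θ + freq k) x • (Complex.I • symbolC (θ + freq k) a) := fun x => by
    rw [maxwellG_wave_smul _ (differentiable_const a), maxwellG_const, zero_add]
  simp only [h2, inner_wave_smul_left] at h1
  rw [integral_inner (integrable_wave_smul _ _), integral_inner (integrable_wave_smul _ _)] at h1
  change inner ℂ a (coef θ _ k) = -inner ℂ _ (coef θ u k) at h1
  rw [h1, inner_smul_left, inner_smul_right, inner_symbolC, Complex.conj_I]
  ring

/-- The maximal operator `A₀⁻¹ G` is skew-symmetric for the inner product weighted by `A₀`: by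
Parseval's identity this reduces to the symmetry of the symbol. -/
theorem PeriodicMedium.InGraph.skew {u f v g : L2cell} (h : M.InGraph θ u f)
    (k : M.InGraph θ v g) : inner ℂ (weightOp M f) v = -inner ℂ u (weightOp M g) := by
  obtain ⟨C, hC, hP⟩ := hasSum_inner_coef
  have h1 := hP θ (weightOp M f) v
  have h2 := (hP θ u (weightOp M g)).neg
  have h3 := h1.unique (h2.congr_fun fun n => by
    rw [h.coef_eq, k.coef_eq, inner_smul_left, inner_smul_right, inner_symbolC, Complex.conj_I]
    ring)
  rw [← mul_neg] at h3
  exact mul_left_cancel₀ hC h3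

/-- The graph of `A₀⁻¹ G` on `θ`-periodic fields, as a linear relation. -/
def graph (M : PeriodicMedium) (θ : R3) : Submodule ℂ (L2cell × L2cell) where
  carrier := {p | M.InGraph θ p.1 p.2}
  zero_mem' := by
    have h := (M.eigenspace θ 0).zero_mem
    change M.InGraph θ 0 ((0 : ℂ) • 0) at h
    rwa [smul_zero] at h
  add_mem' := fun h k => PeriodicMedium.InGraph.add h k
  smul_mem' := fun c _ h => PeriodicMedium.InGraph.smul c h

/-- The scalar field of operators `x ↦ e^{iη·x}`. -/
def waveC (η x : R3) : C6 →L[ℂ] C6 := wave η x • ContinuousLinearMap.id ℂ C6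

theorem continuous_waveC (η : R3) : Continuous (waveC η) :=
  (contDiff_wave η).continuous.smul continuous_const

/-- Multiplication by `e^{iη·x}` on `L²` of the cell. -/
def waveOp (η : R3) : L2cell →L[ℂ] L2cell := mulL2 (waveC η) (continuous_waveC η)

theorem coeFn_waveOp (η : R3) (u : L2cell) :
    waveOp η u =ᵐ[volume.restrict cell] fun x => wave η x • u x :=
  coeFn_mulL2 _ u

/-- Multiplication by the constant matrix `S(η)`. -/
def symbolOp (η : R3) : L2cell →L[ℂ] L2cell := mulL2 (fun _ => symbolC η) continuous_const

theorem coeFn_symbolOp (η : R3) (u : L2cell) :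
    symbolOp η u =ᵐ[volume.restrict cell] fun x => symbolC η (u x) :=
  coeFn_mulL2 _ u

theorem waveOp_ne_zero (η : R3) {u : L2cell} (hu : u ≠ 0) : waveOp η u ≠ 0 := by
  intro h
  apply hu
  rw [Lp.eq_zero_iff_ae_eq_zero] at h ⊢
  filter_upwards [h, coeFn_waveOp η u] with x h1 h2
  rw [h1, Pi.zero_apply] at h2
  have h3 : wave η x ≠ 0 := by
    rw [← norm_ne_zero_iff, norm_wave]; exact one_ne_zero
  exact (smul_eq_zero.mp h2.symm).resolve_left h3

theorem weightOp_waveOp (η : R3) (u : L2cell) :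
    weightOp M (waveOp η u) = waveOp η (weightOp M u) := by
  apply Lp.ext
  filter_upwards [coeFn_waveOp η u, coeFn_waveOp η (weightOp M u),
    coeFn_mulL2 M.continuous_A0C u, coeFn_mulL2 M.continuous_A0C (waveOp η u)] with x h1 h2 h3 h4
  rw [h2, weightOp, h3, h4, h1, map_smul]

theorem symbolC_smul (t : ℝ) (η : R3) : symbolC (t • η) = (t : ℂ) • symbolC η := by
  rw [symbolC, symbolC, ← map_smul]
  congr 1
  ext i j
  rcases i with i | i <;> rcases j with j | j <;> fin_cases i <;> fin_cases j <;>
    simp [symbol, wedge]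

theorem symbolOp_smul (t : ℝ) (η : R3) (u : L2cell) :
    symbolOp (t • η) u = (t : ℂ) • symbolOp η u := by
  apply Lp.ext
  filter_upwards [coeFn_symbolOp (t • η) u, coeFn_symbolOp η u,
    Lp.coeFn_smul (t : ℂ) (symbolOp η u)] with x h1 h2 h3
  rw [h1, h3, Pi.smul_apply, h2, symbolC_smul]
  rfl

/-- Multiplication by `e^{-iζ·x}` carries the operator at the frequency `θ + ζ` to a bounded
perturbation, by `i S(ζ)`, of the operator at `θ`. -/
theorem PeriodicMedium.InGraph.shift {ζ : R3} {v f h : L2cell} (hv : M.InGraph (θ + ζ) v f)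
    (hh : weightOp M h =
      waveOp (-ζ) (weightOp M f) - Complex.I • symbolOp ζ (waveOp (-ζ) v)) :
    M.InGraph θ (waveOp (-ζ) v) h := by
  intro φ hφ
  have h1 := hv _ (hφ.wave_smul ζ)
  rw [integral_inner_weightOp] at h1 ⊢
  have hd : Differentiable ℝ φ := hφ.1.differentiable (by simp)
  simp only [maxwellG_wave_smul ζ hd, inner_wave_smul_left] at h1
  have hψ : Continuous φ := hφ.1.continuous
  have iφ : ∀ w : L2cell, Integrable (fun x => inner ℂ (φ x) (w x)) (volume.restrict cell) :=
    fun w => integrableOn_clm (L := fun x => innerSL ℂ (φ x)) ((innerSL ℂ).continuous.comp hψ) w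
  have e1 : ∫ x in cell, inner ℂ (φ x) (weightOp M h x) =
      ∫ x in cell, (inner ℂ (φ x) (wave (-ζ) x • weightOp M f x) -
        Complex.I * inner ℂ (φ x) (symbolOp ζ (waveOp (-ζ) v) x)) := by
    refine integral_congr_ae ?_
    filter_upwards [coeFn_waveOp (-ζ) (weightOp M f),
      Lp.coeFn_sub (waveOp (-ζ) (weightOp M f)) (Complex.I • symbolOp ζ (waveOp (-ζ) v)),
      Lp.coeFn_smul Complex.I (symbolOp ζ (waveOp (-ζ) v))] with x h2 h3 h4
    rw [hh, h3, Pi.sub_apply, h2, h4, Pi.smul_apply, inner_sub_right,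
      inner_smul_right (φ x) _ Complex.I]
  have e2 : ∫ x in cell, inner ℂ (maxwellG φ x + Complex.I • symbolC ζ (φ x)) (wave (-ζ) x • v x) =
      ∫ x in cell, (inner ℂ (maxwellG φ x) (waveOp (-ζ) v x) -
        Complex.I * inner ℂ (φ x) (symbolOp ζ (waveOp (-ζ) v) x)) := by
    refine integral_congr_ae ?_
    filter_upwards [coeFn_waveOp (-ζ) v, coeFn_symbolOp ζ (waveOp (-ζ) v)] with x h2 h3
    rw [h3, h2, inner_add_left, inner_smul_left, inner_symbolC, Complex.conj_I]
    ring
  have i1 : Integrable (fun x => inner ℂ (φ x) (wave (-ζ) x • weightOp M f x))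
      (volume.restrict cell) := by
    refine (iφ (waveOp (-ζ) (weightOp M f))).congr ?_
    filter_upwards [coeFn_waveOp (-ζ) (weightOp M f)] with x h2
    rw [h2]
  rw [e1, integral_sub i1 ((iφ _).const_mul _), h1, e2,
    integral_sub (integrable_right hφ _) ((iφ _).const_mul _)]
  ring

end Graph

/-! ### The bound on the group velocity -/

section GroupVelocity

variable {M : PeriodicMedium} {θ : R3}

theorem mem_spectrum_of_eigenvector {z : ℂ} {u : L2cell} (hu : u ∈ M.eigenspace θ z)
    (hu0 : u ≠ 0) : z ∈ M.spectrum θ := by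
  intro h
  have h1 : M.InGraph θ u (z • u - 0) := by rw [sub_zero]; exact hu
  have h2 : M.InGraph θ 0 (z • (0 : L2cell) - 0) := by
    rw [sub_zero]; exact (M.eigenspace θ z).zero_mem
  exact hu0 ((h 0).unique h1 h2)

theorem exists_eigenvector {z : ℂ} {κ : ℕ} (hκ : 1 ≤ κ)
    (h : Module.finrank ℂ (M.eigenspace θ z) = κ) : ∃ u ∈ M.eigenspace θ z, u ≠ 0 := by
  have : Nontrivial (M.eigenspace θ z) := Module.nontrivial_of_finrank_pos (R := ℂ) (by omega)
  obtain ⟨u, hu⟩ := exists_ne (0 : M.eigenspace θ z)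
  exact ⟨u, u.2, fun h => hu (Subtype.ext h)⟩

/-- The directional derivative of the dispersion relation is at most `τ_max`. -/
theorem PeriodicMedium.ConstantMultiplicity.inner_gradient_le {θ₀ : R3} {ω₀ : ℝ} {κ : ℕ}
    {ω : R3 → ℝ} (hω : M.ConstantMultiplicity θ₀ ω₀ κ ω) (η : R3) :
    inner ℝ (gradient ω θ₀) η ≤ M.tauMax η := by
  obtain ⟨δ₁, hδ₁, δ₂, hδ₂, han, hspec⟩ := hω.exists_radii
  have hθ₀ : θ₀ ∈ Metric.ball θ₀ δ₁ := Metric.mem_ball_self hδ₁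
  have hω₀ : ω θ₀ = ω₀ := by
    obtain ⟨u, hu, hu0⟩ := exists_eigenvector hω.one_le_mult hω.mult_eq
    have h1 : Complex.I * (ω₀ : ℂ) ∈ M.spectrum θ₀ ∩ Metric.ball (Complex.I * (ω₀ : ℂ)) δ₂ :=
      ⟨mem_spectrum_of_eigenvector hu hu0, Metric.mem_ball_self hδ₂⟩
    rw [(hspec θ₀ hθ₀).1, mem_singleton_iff] at h1
    exact_mod_cast (mul_left_cancel₀ Complex.I_ne_zero h1).symm
  obtain ⟨c, hc, hcoer⟩ := exists_weightOp_coercive M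
  have hres : ∀ ζ : ℂ, ζ ≠ Complex.I * ω₀ → ‖ζ - Complex.I * ω₀‖ < δ₂ →
      ∀ g : L2cell, ∃! u : L2cell, (u, ζ • u - g) ∈ graph M θ₀ := by
    intro ζ hζ hζδ
    by_contra hcon
    have h1 : ζ ∈ M.spectrum θ₀ ∩ Metric.ball (Complex.I * (ω₀ : ℂ)) δ₂ :=
      ⟨hcon, by rwa [Metric.mem_ball, dist_eq_norm]⟩
    rw [(hspec θ₀ hθ₀).1, hω₀] at h1
    exact hζ h1
  have hν : HasDerivAt (fun t : ℝ => ω (θ₀ + t • η)) (inner ℝ (gradient ω θ₀) η) 0 := by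
    have h1 : HasFDerivAt ω (InnerProductSpace.toDual ℝ R3 (gradient ω θ₀)) (θ₀ + (0 : ℝ) • η) := by
      rw [zero_smul, add_zero]
      exact (han θ₀ hθ₀).differentiableAt.hasGradientAt.hasFDerivAt
    have h2 : HasDerivAt (fun t : ℝ => θ₀ + t • η) η 0 := by
      simpa using ((hasDerivAt_id (0 : ℝ)).smul_const η).const_add θ₀
    exact h1.comp_hasDerivAt (0 : ℝ) h2
  refine deriv_eigenvalue_le (weightOp M) (isSelfAdjoint_weightOp M) hc hcoer (graph M θ₀)
    (fun p hp q hq => PeriodicMedium.InGraph.skew hp hq) hδ₂ hres (symbolOp η)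
    (re_inner_mulL2_le continuous_const M.continuous_A0C fun x u => re_inner_symbolC_le M x η u)
    hν (by simp [hω₀]) ?_
  have hball : ∀ᶠ t in nhdsWithin (0 : ℝ) (Ioi 0), θ₀ + t • η ∈ Metric.ball θ₀ δ₁ := by
    refine nhdsWithin_le_nhds ?_
    have hcont : Continuous fun t : ℝ => θ₀ + t • η := by fun_prop
    refine hcont.continuousAt.eventually_mem (Metric.isOpen_ball.mem_nhds ?_)
    simpa using hδ₁
  -- Eigenvectors at `θ₀ + t η`, conjugated to the frequency `θ₀`.
  filter_upwards [hball] with t ht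
  obtain ⟨v, hv, hv0⟩ := exists_eigenvector hω.one_le_mult (hspec _ ht).2
  have hv' : M.InGraph (θ₀ + t • η) v ((Complex.I * (ω (θ₀ + t • η) : ℂ)) • v) := hv
  obtain ⟨f, hf⟩ := surjective_weightOp M
    (waveOp (-(t • η)) (weightOp M ((Complex.I * (ω (θ₀ + t • η) : ℂ)) • v)) -
      Complex.I • symbolOp (t • η) (waveOp (-(t • η)) v))
  refine ⟨waveOp (-(t • η)) v, f, waveOp_ne_zero _ hv0, hv'.shift hf, ?_⟩
  rw [hf, symbolOp_smul, map_smul, map_smul, weightOp_waveOp, smul_smul]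

end GroupVelocity

end BlochMaxwell

end

theorem theorem6p1 (M : BlochMaxwell.PeriodicMedium) (θ₀ : BlochMaxwell.R3) (ω₀ : ℝ) (κ : ℕ)
    (ω : BlochMaxwell.R3 → ℝ) (hω : M.ConstantMultiplicity θ₀ ω₀ κ ω)
    (ξ : BlochMaxwell.R3) (hξ : ξ ≠ 0) :
    inner ℝ ξ (BlochMaxwell.groupVelocity ω θ₀) ≤ M.tauMax (-ξ) := by
  have h := hω.inner_gradient_le (-ξ)
  rwa [inner_neg_right, real_inner_comm, ← inner_neg_right] at h
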